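/- Let $n\ge 2$. There exist positive constants $C_0$ and $C$, depending only on $n$, with the following property. Let $\lambda>1$, let $\Omega\subseteq\mathbb{R}^n$ be open, and let $u\in C^4(\Omega)$ be a real-valued solution of $\Delta^2u=\lambda^2u$ in $\Omega$. Put $v=\Delta u-\lambda u$ and, for $y=(x,x_{n+1})\in\Omega\times\mathbb{R}$, $$g(y)=u(x)e^{\sqrt{\lambda}\,x_{n+1}},\qquad h(y)=v(x)e^{\sqrt{\lambda}\,x_{n+1}}.$$ For every closed ball $\overline{B_r(y_0)}\subset\Omega\times\mathbb{R}\subseteq\mathbb{R}^{n+1}$ with $r>0$ on whose boundary $(g,h)$ does not vanish identically, define the frequency $$N(y_0,r)=r\,\frac{\int_{B_r(y_0)}\left(|\nabla g|^2+|\nabla h|^2+gh+2\lambda g^2\right)dy}{\int_{\partial B_r(y_0)}\left(g^2+h^2\right)d\sigma},$$ where $\sigma$ is the $n$-dimensional surface (Hausdorff) measure on $\partial B_r(y_0)$. Then, whenever $\overline{B_r(y_0)}\subset\Omega\times\mathbb{R}$, $0<r\le 1$ and $N(y_0,r)\ge C_0$, the function $s\mapsto \ln N(y_0,s)$ is differentiable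 at $s=r$ and $$\frac{d\ln N(y_0,s)}{ds}\bigg|_{s=r}\ge -C.$$ -/

import Mathlib

open MeasureTheory

noncomputable section

namespace Biharmonic

/-- The first `n` coordinates `x` of a point `y = (x, x_{n+1})` of `ℝⁿ⁺¹`. -/
def spacePart {n : ℕ} (y : EuclideanSpace ℝ (Fin (n + 1))) : EuclideanSpace ℝ (Fin n) :=
  WithLp.toLp 2 (fun i : Fin n => y i.castSucc)

/-- The last coordinate `x_{n+1}` of a point `y = (x, x_{n+1})` of `ℝⁿ⁺¹`. -/
def lastPart {n : ℕ} (y : EuclideanSpace ℝ (Fin (n + 1))) : ℝ :=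
  y (Fin.last n)

/-- `u` is a classical (four times continuously differentiable) solution of
`Δ² u = lam² u` in `Ω`. -/
def IsEigenfunctionOn {n : ℕ} (Ω : Set (EuclideanSpace ℝ (Fin n))) (lam : ℝ)
    (u : EuclideanSpace ℝ (Fin n) → ℝ) : Prop :=
  ContDiffOn ℝ 4 u Ω ∧
    ∀ x ∈ Ω, Laplacian.laplacian (Laplacian.laplacian u) x = lam ^ 2 * u x

/-- `v = (Δ - lam) u`. -/
def vFun {n : ℕ} (lam : ℝ) (u : EuclideanSpace ℝ (Fin n) → ℝ)
    (x : EuclideanSpace ℝ (Fin n)) : ℝ :=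
  Laplacian.laplacian u x - lam * u x

/-- `(x, x_{n+1}) ↦ w x * exp (√lam * x_{n+1})`. -/
def lift {n : ℕ} (lam : ℝ) (w : EuclideanSpace ℝ (Fin n) → ℝ)
    (y : EuclideanSpace ℝ (Fin (n + 1))) : ℝ :=
  w (spacePart y) * Real.exp (Real.sqrt lam * lastPart y)

/-- `g = u e^{√lam x_{n+1}}`. -/
def gFun {n : ℕ} (lam : ℝ) (u : EuclideanSpace ℝ (Fin n) → ℝ) :
    EuclideanSpace ℝ (Fin (n + 1)) → ℝ :=
  lift lam u

/-- `h = v e^{√lam x_{n+1}}`. -/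
def hFun {n : ℕ} (lam : ℝ) (u : EuclideanSpace ℝ (Fin n) → ℝ) :
    EuclideanSpace ℝ (Fin (n + 1)) → ℝ :=
  lift lam (vFun lam u)

/-- The `n`-dimensional surface measure `dσ` on the sphere `∂B_r(y₀)` of `ℝⁿ⁺¹`, `r > 0`, as a
measure on `ℝⁿ⁺¹`: the image under `ω ↦ y₀ + r ω`, times `rⁿ`, of the surface measure
`Measure.toSphere` of the unit sphere (which is the `n`-dimensional Hausdorff measure, normalized
so as to agree with Lebesgue measure on `ℝⁿ`). -/
def surfaceMeasure {n : ℕ} (y₀ : EuclideanSpace ℝ (Fin (n + 1))) (r : ℝ) :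
    Measure (EuclideanSpace ℝ (Fin (n + 1))) :=
  ENNReal.ofReal (r ^ n) •
    ((volume : Measure (EuclideanSpace ℝ (Fin (n + 1)))).toSphere.map
      (fun ω : Metric.sphere (0 : EuclideanSpace ℝ (Fin (n + 1))) 1 =>
        y₀ + r • (ω : EuclideanSpace ℝ (Fin (n + 1)))))

/-- `D(y₀, r) = ∫_{B_r(y₀)} (|∇g|² + |∇h|² + g h + 2 lam g²) dy`. -/
def D {n : ℕ} (lam : ℝ) (u : EuclideanSpace ℝ (Fin n) → ℝ)
    (y₀ : EuclideanSpace ℝ (Fin (n + 1))) (r : ℝ) : ℝ :=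
  ∫ y in Metric.ball y₀ r,
    (‖gradient (gFun lam u) y‖ ^ 2 + ‖gradient (hFun lam u) y‖ ^ 2
      + gFun lam u y * hFun lam u y + 2 * lam * gFun lam u y ^ 2)

/-- `H(y₀, r) = ∫_{∂B_r(y₀)} (g² + h²) dσ`. -/
def H {n : ℕ} (lam : ℝ) (u : EuclideanSpace ℝ (Fin n) → ℝ)
    (y₀ : EuclideanSpace ℝ (Fin (n + 1))) (r : ℝ) : ℝ :=
  ∫ y, (gFun lam u y ^ 2 + hFun lam u y ^ 2) ∂(surfaceMeasure y₀ r)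

/-- The frequency `N(y₀, r) = r D(y₀, r) / H(y₀, r)`. -/
def frequency {n : ℕ} (lam : ℝ) (u : EuclideanSpace ℝ (Fin n) → ℝ)
    (y₀ : EuclideanSpace ℝ (Fin (n + 1))) (r : ℝ) : ℝ :=
  r * (D lam u y₀ r / H lam u y₀ r)

end Biharmonic

end

/-!
The frequency of `(g, h)` is almost monotone because the lift by `e^{√lam x_{n+1}}` turns the fourth
order equation into a second order system with a good sign: `Δg = 2 lam g + h` and `Δh = 0`
(`IsEigenfunctionOn.laplacian_gFun`, `IsEigenfunctionOn.laplacian_hFun`). For such a pair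
`|∇g|² + |∇h|² + g h + 2 lam g²` is the divergence of `g ∇g + h ∇h`, so that, with `ν` the outer
normal, `D = ∫_{∂B} (g g_ν + h h_ν)`, and `H' = (n / r) H + 2 D`.

The derivative `D'` is the integral of the same density over the sphere. The Rellich identity
rewrites it as `2 ∫_{∂B} (g_ν² + h_ν²) + ((n - 1) / r) D` plus an error
(`rellich_energyDensity`). In `1 / r + D' / D - H' / H` the powers of `1 / r` cancel, and
`2 ∫_{∂B} (g_ν² + h_ν²) / D ≥ 2 D / H` is the Cauchy-Schwarz inequality. It remains to bound the
error below by a multiple of `-D`. The dangerous boundary term `2 lam ∫_{∂B} g²` is cancelled by the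
divergence theorem for `g² y`, the interior terms with `lam` have a favourable sign, and the rest
is controlled by `D`, by `∫_B h² ≤ r H` (as `h²` is subharmonic) and by `H ≤ r D`, which is the
hypothesis that the frequency is at least `1`. So the constants `1` and `n² + 4` work.

The divergence theorem on a ball (`setIntegral_ball_fderiv_eq_integral_toSphere`) is obtained from
integration by parts against the Lipschitz function `max (r² - |y|²) 0`: this gives
`∫_{B_r} (r² - |y|²) ∂_e f = 2 ∫_{B_r} ⟪y, e⟫ f`, and the derivative of both sides in `r` is, up to
the factor `2 r`, the divergence theorem.
-/

namespace Biharmonic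

open Metric Set Filter Topology

/-! ### Polar coordinates and integrals over spheres -/

section Polar

variable {E : Type*} [NormedAddCommGroup E] [NormedSpace ℝ E] [MeasurableSpace E] [BorelSpace E]
  [FiniteDimensional ℝ E] [Nontrivial E]

/-- Integration over a ball in polar coordinates, for functions that need not be radial. -/
theorem setIntegral_ball_eq_intervalIntegral_toSphere (μ : Measure E) [μ.IsAddHaarMeasure]
    (f : E → ℝ) {r : ℝ} (hr : 0 ≤ r) (hf : IntegrableOn f (ball 0 r) μ) :
    ∫ x in ball 0 r, f x ∂μ =
      ∫ s in (0 : ℝ)..r, s ^ (Module.finrank ℝ E - 1) *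
        ∫ ω : sphere (0 : E) 1, f (s • (ω : E)) ∂μ.toSphere := by
  have hg : Integrable ((ball (0 : E) r).indicator f) μ :=
    (integrable_indicator_iff measurableSet_ball).2 hf
  set g := (ball (0 : E) r).indicator f with hgdef
  have hmp := μ.measurePreserving_homeomorphUnitSphereProd
  have hemb := (homeomorphUnitSphereProd E).measurableEmbedding
  let G : sphere (0 : E) 1 × Ioi (0 : ℝ) → ℝ := fun p => g (p.2.1 • p.1.1)
  have hG : ∀ x : ({0}ᶜ : Set E), G (homeomorphUnitSphereProd E x) = g x := by
    intro x
    have hx : ‖(x : E)‖ ≠ 0 := norm_ne_zero_iff.2 x.2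
    simp [G, smul_smul, hx]
  have hGint : Integrable G
      (μ.toSphere.prod (Measure.volumeIoiPow (Module.finrank ℝ E - 1))) := by
    rw [← hmp.integrable_comp_emb hemb]
    have : G ∘ homeomorphUnitSphereProd E = g ∘ ((↑) : ({0}ᶜ : Set E) → E) := by
      funext x; exact hG x
    rw [this, ← integrableOn_iff_comap_subtypeVal (measurableSet_singleton _).compl]
    exact hg.integrableOn
  have hin : ∀ s : ℝ, 0 < s → ∫ ω : sphere (0 : E) 1, g (s • (ω : E)) ∂μ.toSphere =
      (Iio r).indicator (fun s => ∫ ω : sphere (0 : E) 1, f (s • (ω : E)) ∂μ.toSphere) s := by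
    intro s hs
    by_cases h : s < r
    · rw [indicator_of_mem (show s ∈ Iio r from h)]
      congr 1; funext ω
      rw [hgdef, indicator_of_mem]
      simpa [norm_smul, abs_of_pos hs] using h
    · rw [indicator_of_notMem (show s ∉ Iio r from h)]
      rw [← integral_zero (sphere (0 : E) 1) ℝ (μ := μ.toSphere)]
      congr 1; funext ω
      rw [hgdef, indicator_of_notMem]
      simpa [norm_smul, abs_of_pos hs] using h
  calc ∫ x in ball 0 r, f x ∂μ = ∫ x, g x ∂μ := (integral_indicator measurableSet_ball).symm
    _ = ∫ x : ({(0)}ᶜ : Set E), g x ∂(μ.comap (↑)) := by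
      rw [integral_subtype_comap (measurableSet_singleton _).compl g, restrict_compl_singleton]
    _ = ∫ p, G p ∂(μ.toSphere.prod (Measure.volumeIoiPow (Module.finrank ℝ E - 1))) := by
      rw [← hmp.integral_comp hemb]
      exact integral_congr_ae (.of_forall fun x => (hG x).symm)
    _ = ∫ s : Ioi (0 : ℝ), ∫ ω : sphere (0 : E) 1, g (s.1 • (ω : E)) ∂μ.toSphere
          ∂(Measure.volumeIoiPow (Module.finrank ℝ E - 1)) := integral_prod_symm _ hGint
    _ = ∫ s in Ioi (0 : ℝ), s ^ (Module.finrank ℝ E - 1) *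
          ∫ ω : sphere (0 : E) 1, g (s • (ω : E)) ∂μ.toSphere := by
      simp only [Measure.volumeIoiPow, ENNReal.ofReal]
      rw [integral_withDensity_eq_integral_smul
        ((measurable_subtype_coe.pow_const _).real_toNNReal),
        integral_subtype_comap measurableSet_Ioi fun a : ℝ ↦
          Real.toNNReal (a ^ (Module.finrank ℝ E - 1)) •
            ∫ ω : sphere (0 : E) 1, g (a • (ω : E)) ∂μ.toSphere,
        setIntegral_congr_fun measurableSet_Ioi fun x hx ↦ ?_]
      simp only [NNReal.smul_def, Real.coe_toNNReal _ (pow_nonneg (le_of_lt hx) _), smul_eq_mul]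
    _ = ∫ s in Ioi (0 : ℝ), (Iio r).indicator (fun s => s ^ (Module.finrank ℝ E - 1) *
          ∫ ω : sphere (0 : E) 1, f (s • (ω : E)) ∂μ.toSphere) s := by
      refine setIntegral_congr_fun measurableSet_Ioi fun s hs => ?_
      simp only [hin s hs]
      by_cases h : s < r <;> simp [h]
    _ = _ := by
      rw [setIntegral_indicator measurableSet_Iio, Ioi_inter_Iio,
        intervalIntegral.integral_of_le hr, integral_Ioc_eq_integral_Ioo]

theorem smul_sphere_mem_ball {E : Type*} [NormedAddCommGroup E] [NormedSpace ℝ E]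
    {R s : ℝ} (hs : s ∈ Ioo (-R) R) (ω : sphere (0 : E) 1) :
    s • (ω : E) ∈ ball (0 : E) R := by
  simpa [norm_smul, abs_lt] using hs

theorem continuousOn_integral_toSphere {E : Type*} [NormedAddCommGroup E] [NormedSpace ℝ E]
    [MeasurableSpace E] [BorelSpace E] [FiniteDimensional ℝ E] (μ : Measure E) [μ.IsAddHaarMeasure]
    {f : E → ℝ} {R : ℝ} (hf : ContinuousOn f (ball 0 R)) :
    ContinuousOn (fun s : ℝ => ∫ ω : sphere (0 : E) 1, f (s • (ω : E)) ∂μ.toSphere)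
      (Ioo (-R) R) := by
  rw [continuousOn_iff_continuous_domRestrict]
  have : LocallyCompactSpace (Ioo (-R) R) := isOpen_Ioo.locallyCompactSpace
  have h := continuous_parametric_integral_of_continuous (X := Ioo (-R) R)
    (Y := sphere (0 : E) 1) (μ := μ.toSphere) (s := univ)
    (f := fun s ω => f (s.1 • (ω : E))) (by
      refine hf.comp_continuous (by fun_prop) fun p => smul_sphere_mem_ball p.1.2 p.2)
    isCompact_univ
  simp only [Measure.restrict_univ] at h
  exact h

theorem integrable_toSphere {E : Type*} [NormedAddCommGroup E] [NormedSpace ℝ E]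
    [MeasurableSpace E] [BorelSpace E] [FiniteDimensional ℝ E] (μ : Measure E) [μ.IsAddHaarMeasure]
    {f : E → ℝ} {R s : ℝ} (hf : ContinuousOn f (ball 0 R)) (hs : s ∈ Ioo (-R) R) :
    Integrable (fun ω : sphere (0 : E) 1 => f (s • (ω : E))) μ.toSphere := by
  have : Continuous fun ω : sphere (0 : E) 1 => f (s • (ω : E)) :=
    hf.comp_continuous (by fun_prop) (smul_sphere_mem_ball hs)
  exact this.integrable_of_hasCompactSupport (HasCompactSupport.of_compactSpace _)

theorem integrableOn_ball_of_continuousOn {E : Type*} [NormedAddCommGroup E] [NormedSpace ℝ E]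
    [MeasurableSpace E] [BorelSpace E] [FiniteDimensional ℝ E] (μ : Measure E) [μ.IsAddHaarMeasure]
    {f : E → ℝ} {R s : ℝ} (hf : ContinuousOn f (ball 0 R)) (hs : s < R) :
    IntegrableOn f (ball 0 s) μ :=
  ((hf.mono (closedBall_subset_ball hs)).integrableOn_compact
    (isCompact_closedBall _ _)).mono_set ball_subset_closedBall

theorem hasDerivAt_setIntegral_ball (μ : Measure E) [μ.IsAddHaarMeasure]
    {f : E → ℝ} {R r : ℝ} (hf : ContinuousOn f (ball 0 R)) (hr : 0 < r) (hrR : r < R) :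
    HasDerivAt (fun s => ∫ x in ball 0 s, f x ∂μ)
      (r ^ (Module.finrank ℝ E - 1) *
        ∫ ω : sphere (0 : E) 1, f (r • (ω : E)) ∂μ.toSphere) r := by
  have hc : ContinuousOn (fun s : ℝ => s ^ (Module.finrank ℝ E - 1) *
        ∫ ω : sphere (0 : E) 1, f (s • (ω : E)) ∂μ.toSphere) (Ioo (-R) R) :=
    (by fun_prop : Continuous fun s : ℝ => s ^ (Module.finrank ℝ E - 1)).continuousOn.mul
      (continuousOn_integral_toSphere μ hf)
  have hmem : Ioo (-R) R ∈ 𝓝 r := Ioo_mem_nhds (by linarith) hrR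
  have h := intervalIntegral.integral_hasDerivAt_right (a := 0) (b := r)
    (ContinuousOn.intervalIntegrable (hc.mono (by
      rw [uIcc_of_le hr.le]; exact fun x hx => ⟨by linarith [hx.1], by linarith [hx.2]⟩)))
    (hc.stronglyMeasurableAtFilter isOpen_Ioo r ⟨by linarith, hrR⟩) (hc.continuousAt hmem)
  refine h.congr_of_eventuallyEq ?_
  filter_upwards [Ioo_mem_nhds hr hrR] with s hs
  exact setIntegral_ball_eq_intervalIntegral_toSphere μ f hs.1.le
    (integrableOn_ball_of_continuousOn μ hf hs.2)

theorem hasDerivAt_integral_toSphere {E : Type*} [NormedAddCommGroup E] [NormedSpace ℝ E]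
    [MeasurableSpace E] [BorelSpace E] [FiniteDimensional ℝ E] (μ : Measure E) [μ.IsAddHaarMeasure]
    {f : E → ℝ} {R r : ℝ} (hf : ContDiffOn ℝ 1 f (ball 0 R)) (hr : r ∈ Ioo (-R) R) :
    HasDerivAt (fun s => ∫ ω : sphere (0 : E) 1, f (s • (ω : E)) ∂μ.toSphere)
      (∫ ω : sphere (0 : E) 1, fderiv ℝ f (r • (ω : E)) ω ∂μ.toSphere) r := by
  have hdf : ContinuousOn (fderiv ℝ f) (ball 0 R) :=
    hf.continuousOn_fderiv_of_isOpen isOpen_ball le_rfl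
  -- On a smaller closed ball the derivative is bounded, by compactness.
  obtain ⟨R', hR', hR'R⟩ := exists_between (abs_lt.2 hr)
  obtain ⟨C, hC⟩ := (isCompact_closedBall (0 : E) R').exists_bound_of_continuousOn
    (hdf.mono (closedBall_subset_ball hR'R))
  have hmeas : ∀ s ∈ Ioo (-R) R, AEStronglyMeasurable
      (fun ω : sphere (0 : E) 1 => f (s • (ω : E))) μ.toSphere := fun s hs =>
    (integrable_toSphere μ hf.continuousOn hs).aestronglyMeasurable
  have hsub : Ioo (-R') R' ⊆ Ioo (-R) R := Ioo_subset_Ioo (by linarith) hR'R.le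
  refine (hasDerivAt_integral_of_dominated_loc_of_deriv_le (s := Ioo (-R') R')
    (bound := fun _ => C) (F := fun s (ω : sphere (0 : E) 1) => f (s • (ω : E)))
    (F' := fun s ω => fderiv ℝ f (s • (ω : E)) ω)
    (Ioo_mem_nhds (abs_lt.1 hR').1 (abs_lt.1 hR').2)
    ?_ (integrable_toSphere μ hf.continuousOn hr) ?_ ?_ (integrable_const _) ?_).2
  · filter_upwards [Ioo_mem_nhds hr.1 hr.2] with s hs using hmeas s hs
  · have : Continuous fun ω : sphere (0 : E) 1 => fderiv ℝ f (r • (ω : E)) ω :=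
      (hdf.comp_continuous (by fun_prop) (smul_sphere_mem_ball hr)).clm_apply
        continuous_subtype_val
    exact this.aestronglyMeasurable
  · refine .of_forall fun ω s hs => ?_
    have h1 := hC (s • (ω : E)) (ball_subset_closedBall (smul_sphere_mem_ball hs ω))
    calc ‖fderiv ℝ f (s • (ω : E)) ω‖ ≤ ‖fderiv ℝ f (s • (ω : E))‖ * ‖(ω : E)‖ :=
          ContinuousLinearMap.le_opNorm _ _
      _ ≤ C := by simpa using h1
  · refine .of_forall fun ω s hs => ?_
    have hd : HasFDerivAt f (fderiv ℝ f (s • (ω : E))) (s • (ω : E)) :=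
      ((hf.differentiableOn (by simp)).differentiableAt
        (isOpen_ball.mem_nhds (smul_sphere_mem_ball (hsub hs) ω))).hasFDerivAt
    have hl : HasDerivAt (fun t : ℝ => t • (ω : E)) (ω : E) s := by
      simpa using (hasDerivAt_id s).smul_const (ω : E)
    exact hd.comp_hasDerivAt s hl

end Polar

/-! ### The divergence theorem on a ball -/

section Divergence

variable {E : Type*} [NormedAddCommGroup E] [InnerProductSpace ℝ E] [MeasurableSpace E]
  [BorelSpace E] [FiniteDimensional ℝ E]

theorem exists_contDiff_hasCompactSupport_eqOn_ball {E : Type*} [NormedAddCommGroup E]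
    [InnerProductSpace ℝ E] [FiniteDimensional ℝ E] {f : E → ℝ} {r R : ℝ} (hr : 0 < r)
    (hrR : r < R) (hf : ContDiffOn ℝ 1 f (ball 0 R)) :
    ∃ F : E → ℝ, ContDiff ℝ 1 F ∧ HasCompactSupport F ∧ EqOn F f (ball 0 r) := by
  obtain ⟨R', h1, h2⟩ := exists_between hrR
  let χ : ContDiffBump (0 : E) := ⟨r, R', hr, h1⟩
  refine ⟨fun y => χ y * f y, ?_, χ.hasCompactSupport.mul_right, fun y hy => ?_⟩
  · rw [contDiff_iff_contDiffAt]
    intro x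
    by_cases hx : x ∈ ball (0 : E) R
    · exact χ.contDiffAt.mul (hf.contDiffAt (isOpen_ball.mem_nhds hx))
    · have hx' : x ∉ tsupport χ := by
        rw [χ.tsupport_eq]
        exact fun h => hx (closedBall_subset_ball h2 h)
      refine (contDiffAt_const (c := (0 : ℝ))).congr_of_eventuallyEq ?_
      filter_upwards [(isClosed_tsupport χ).isOpen_compl.mem_nhds hx'] with y hy
      rw [image_eq_zero_of_notMem_tsupport hy, zero_mul]
  · have : χ y = 1 := χ.one_of_mem_closedBall (ball_subset_closedBall hy)
    simp [this]

/-- Integration by parts against the Lipschitz weight `max (r² - |y|²) 0`. It has no boundary term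
because the weight vanishes on the sphere. -/
theorem setIntegral_ball_sub_norm_sq_mul_fderiv (μ : Measure E) [μ.IsAddHaarMeasure]
    {f : E → ℝ} {r R : ℝ} (hr : 0 < r)
    (hrR : r < R) (hf : ContDiffOn ℝ 1 f (ball 0 R)) (e : E) :
    ∫ y in ball (0 : E) r, (r ^ 2 - ‖y‖ ^ 2) * fderiv ℝ f y e ∂μ =
      ∫ y in ball (0 : E) r, 2 * (inner ℝ y e * f y) ∂μ := by
  obtain ⟨F, hF, hFc, hFf⟩ := exists_contDiff_hasCompactSupport_eqOn_ball hr hrR hf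
  obtain ⟨C, hC⟩ := hF.lipschitzWith_of_hasCompactSupport hFc (by simp)
  -- The weight `max (r² - |y|²) 0`, in a form whose Lipschitz constant can be read off.
  let w : E → ℝ := fun y => r ^ 2 - (min ‖y‖ r) ^ 2
  have hw : LipschitzWith (2 * r).toNNReal w := by
    refine LipschitzWith.of_dist_le_mul fun x y => ?_
    rw [Real.coe_toNNReal _ (by positivity), Real.dist_eq]
    have h1 : |min ‖x‖ r - min ‖y‖ r| ≤ dist x y := by
      refine (abs_min_sub_min_le_max _ _ _ _).trans ?_
      simp only [sub_self, abs_zero, max_le_iff, dist_eq_norm]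
      exact ⟨abs_norm_sub_norm_le x y, norm_nonneg _⟩
    have h2 : |min ‖x‖ r + min ‖y‖ r| ≤ 2 * r := by
      have a := min_le_right ‖x‖ r
      have b := min_le_right ‖y‖ r
      have c : 0 ≤ min ‖x‖ r := le_min (norm_nonneg _) hr.le
      have d : 0 ≤ min ‖y‖ r := le_min (norm_nonneg _) hr.le
      rw [abs_of_nonneg (by positivity)]
      linarith
    have h3 : w x - w y = -((min ‖x‖ r + min ‖y‖ r) * (min ‖x‖ r - min ‖y‖ r)) := by
      simp only [w]; ring
    rw [h3, abs_neg, abs_mul]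
    gcongr
  have hw0 : ∀ y, r ≤ ‖y‖ → w y = 0 := fun y hy => by simp [w, hy]
  have hw1 : ∀ y, ‖y‖ ≤ r → w y = r ^ 2 - ‖y‖ ^ 2 := fun y hy => by simp [w, hy]
  have hwc : HasCompactSupport w :=
    HasCompactSupport.intro (isCompact_closedBall (0 : E) r) fun y hy => hw0 y (by
      simpa using (lt_of_not_ge fun h => hy (by simpa using h)).le)
  have key := hC.integral_lineDeriv_mul_eq hw hwc (μ := μ) e
  have hL : ∫ y, lineDeriv ℝ F y e * w y ∂μ =
      ∫ y in ball (0 : E) r, (r ^ 2 - ‖y‖ ^ 2) * fderiv ℝ f y e ∂μ := by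
    rw [← integral_indicator measurableSet_ball]
    refine integral_congr_ae (.of_forall fun y => ?_)
    by_cases hy : y ∈ ball (0 : E) r
    · have hFy : F =ᶠ[𝓝 y] f := hFf.eventuallyEq_of_mem (isOpen_ball.mem_nhds hy)
      simp only [indicator_of_mem hy]
      rw [((hF.differentiable (by simp)) y).lineDeriv_eq_fderiv, hFy.fderiv_eq,
        hw1 y (by simpa using (mem_ball_zero_iff.1 hy).le), mul_comm]
    · simp only [indicator_of_notMem hy]
      rw [hw0 y (by simpa using hy), mul_zero]
  have hR : ∫ y, lineDeriv ℝ w y (-e) * F y ∂μ =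
      ∫ y in ball (0 : E) r, 2 * (inner ℝ y e * f y) ∂μ := by
    rw [← integral_indicator measurableSet_ball]
    -- The weight need not be differentiable on the sphere, which is a null set.
    have hs : ∀ᵐ y ∂μ, y ∉ sphere (0 : E) r :=
      measure_eq_zero_iff_ae_notMem.1 (Measure.addHaar_sphere_of_ne_zero μ 0 hr.ne')
    refine integral_congr_ae ?_
    filter_upwards [hs] with y hy
    rcases lt_or_gt_of_ne (show ‖y‖ ≠ r by simpa using hy) with h | h
    · have hyb : y ∈ ball (0 : E) r := by simpa using h
      have hwy : w =ᶠ[𝓝 y] fun y => r ^ 2 - ‖y‖ ^ 2 := by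
        filter_upwards [isOpen_ball.mem_nhds hyb] with z hz
        exact hw1 z (by simpa using (mem_ball_zero_iff.1 hz).le)
      have hd : HasFDerivAt (fun y : E => r ^ 2 - ‖y‖ ^ 2) (-(2 • innerSL ℝ y)) y :=
        (hasStrictFDerivAt_norm_sq y).hasFDerivAt.const_sub _
      have hd' := hd.congr_of_eventuallyEq hwy
      rw [indicator_of_mem hyb, (hd'.hasLineDerivAt (-e)).lineDeriv, hFf hyb]
      simp
      ring
    · have hyb : y ∉ ball (0 : E) r := by simpa using h.le
      have hwy : w =ᶠ[𝓝 y] fun _ => (0 : ℝ) := by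
        filter_upwards [(isOpen_lt continuous_const continuous_norm).mem_nhds h] with z hz
        exact hw0 z (le_of_lt hz)
      have hd' := (hasFDerivAt_const (𝕜 := ℝ) (0 : ℝ) y).congr_of_eventuallyEq hwy
      rw [indicator_of_notMem hyb, (hd'.hasLineDerivAt (-e)).lineDeriv]
      simp
  rw [← hL, key, hR]

/-- The divergence theorem on a ball for the field `f e` with a constant vector `e`: it is the
derivative in `r` of the identity `setIntegral_ball_sub_norm_sq_mul_fderiv`. -/
theorem setIntegral_ball_fderiv_eq_integral_toSphere [Nontrivial E] (μ : Measure E)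
    [μ.IsAddHaarMeasure] {f : E → ℝ} {r R : ℝ} (hr : 0 < r)
    (hrR : r < R) (hf : ContDiffOn ℝ 1 f (ball 0 R)) (e : E) :
    ∫ y in ball (0 : E) r, fderiv ℝ f y e ∂μ =
      r ^ (Module.finrank ℝ E - 1) *
        ∫ ω : sphere (0 : E) 1, f (r • (ω : E)) * inner ℝ (ω : E) e ∂μ.toSphere := by
  have hdf : ContinuousOn (fun y => fderiv ℝ f y e) (ball 0 R) :=
    (hf.continuousOn_fderiv_of_isOpen isOpen_ball le_rfl).clm_apply continuousOn_const
  have hdf2 : ContinuousOn (fun y => ‖y‖ ^ 2 * fderiv ℝ f y e) (ball 0 R) :=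
    (by fun_prop : Continuous fun y : E => ‖y‖ ^ 2).continuousOn.mul hdf
  have hfi : ContinuousOn (fun y => 2 * (inner ℝ y e * f y)) (ball 0 R) :=
    continuousOn_const.mul
      ((by fun_prop : Continuous fun y : E => inner ℝ y e).continuousOn.mul hf.continuousOn)
  have h1 := hasDerivAt_setIntegral_ball μ hdf hr hrR
  have h2 := hasDerivAt_setIntegral_ball μ hdf2 hr hrR
  have h3 := hasDerivAt_setIntegral_ball μ hfi hr hrR
  -- The left-hand side is differentiated as `r² ∫ ∂_e f - ∫ |y|² ∂_e f`; the two surface integrals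
  -- of `∂_e f` cancel, and `2 r ∫ ∂_e f` remains.
  have h4 := ((hasDerivAt_id r).pow 2 |>.mul h1).sub h2
  have h5 : (fun s => ∫ y in ball (0 : E) s, 2 * (inner ℝ y e * f y) ∂μ) =ᶠ[𝓝 r]
      ((id ^ 2 * fun s => ∫ y in ball (0 : E) s, fderiv ℝ f y e ∂μ) -
        fun s => ∫ y in ball (0 : E) s, ‖y‖ ^ 2 * fderiv ℝ f y e ∂μ) := by
    filter_upwards [Ioo_mem_nhds hr hrR] with s hs
    rw [← setIntegral_ball_sub_norm_sq_mul_fderiv μ hs.1 hs.2 hf e]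
    simp only [Pi.sub_apply, Pi.mul_apply, Pi.pow_apply, id]
    rw [← integral_const_mul, ← integral_sub]
    · simp only [sub_mul]
    · exact (integrableOn_ball_of_continuousOn μ hdf hs.2).const_mul _
    · exact integrableOn_ball_of_continuousOn μ hdf2 hs.2
  have h6 := h3.unique (h4.congr_of_eventuallyEq h5)
  have e1 : ∫ ω : sphere (0 : E) 1, ‖r • (ω : E)‖ ^ 2 * fderiv ℝ f (r • (ω : E)) e ∂μ.toSphere =
      r ^ 2 * ∫ ω : sphere (0 : E) 1, fderiv ℝ f (r • (ω : E)) e ∂μ.toSphere := by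
    rw [← integral_const_mul]
    congr 1; funext ω
    simp [norm_smul]
  have e2 : ∫ ω : sphere (0 : E) 1, 2 * (inner ℝ (r • (ω : E)) e * f (r • (ω : E))) ∂μ.toSphere =
      2 * r * ∫ ω : sphere (0 : E) 1, f (r • (ω : E)) * inner ℝ (ω : E) e ∂μ.toSphere := by
    rw [← integral_const_mul]
    congr 1; funext ω
    rw [real_inner_smul_left]; ring
  rw [e1, e2] at h6
  have h7 : 2 * r ≠ 0 := by positivity
  apply mul_left_cancel₀ h7
  simp at h6
  linarith

end Divergence

/-! ### Partial derivatives and divergences of the vector fields -/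

section Coordinates

variable {m : ℕ}

/-- The partial derivative `∂ᵢ f`. -/
noncomputable def pderiv (i : Fin m) (f : EuclideanSpace ℝ (Fin m) → ℝ)
    (y : EuclideanSpace ℝ (Fin m)) : ℝ :=
  fderiv ℝ f y (EuclideanSpace.single i 1)

/-- The Euler derivative `y · ∇f(y)`, which is `‖y‖` times the radial derivative of `f`. -/
noncomputable def euler (f : EuclideanSpace ℝ (Fin m) → ℝ) (y : EuclideanSpace ℝ (Fin m)) : ℝ :=
  fderiv ℝ f y y

variable {f g : EuclideanSpace ℝ (Fin m) → ℝ} {y : EuclideanSpace ℝ (Fin m)} {i : Fin m}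

theorem pderiv_sub (hf : DifferentiableAt ℝ f y) (hg : DifferentiableAt ℝ g y) :
    pderiv i (fun z => f z - g z) y = pderiv i f y - pderiv i g y := by
  simp only [pderiv]; rw [fderiv_fun_sub hf hg]; simp

theorem pderiv_mul (hf : DifferentiableAt ℝ f y) (hg : DifferentiableAt ℝ g y) :
    pderiv i (fun z => f z * g z) y = pderiv i f y * g y + f y * pderiv i g y := by
  simp only [pderiv]; rw [fderiv_fun_mul hf hg]; simp; ring

theorem pderiv_const (c : ℝ) : pderiv i (fun _ => c) y = 0 := by
  simp [pderiv]

theorem pderiv_sum {ι : Type*} {s : Finset ι} {F : ι → EuclideanSpace ℝ (Fin m) → ℝ}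
    (hF : ∀ j ∈ s, DifferentiableAt ℝ (F j) y) :
    pderiv i (fun z => ∑ j ∈ s, F j z) y = ∑ j ∈ s, pderiv i (F j) y := by
  simp only [pderiv]; rw [fderiv_fun_sum hF]; simp

theorem differentiableAt_coord (j : Fin m) :
    DifferentiableAt ℝ (fun z : EuclideanSpace ℝ (Fin m) => z j) y := by fun_prop

theorem pderiv_coord (j : Fin m) :
    pderiv i (fun z : EuclideanSpace ℝ (Fin m) => z j) y = if i = j then 1 else 0 := by
  have : HasFDerivAt (fun z : EuclideanSpace ℝ (Fin m) => z j)
      (EuclideanSpace.proj j : EuclideanSpace ℝ (Fin m) →L[ℝ] ℝ) y :=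
    (EuclideanSpace.proj j : EuclideanSpace ℝ (Fin m) →L[ℝ] ℝ).hasFDerivAt
  simp [pderiv, this.fderiv, eq_comm]

theorem pderiv_congr (h : f =ᶠ[𝓝 y] g) : pderiv i f y = pderiv i g y := by
  rw [pderiv, h.fderiv_eq, pderiv]

theorem euler_eq_sum : euler f y = ∑ i, y i * pderiv i f y := by
  have h : y = ∑ i, y i • EuclideanSpace.single i (1 : ℝ) := by
    ext j; simp [Finset.sum_apply, Pi.single_apply]
  conv_lhs => rw [euler, h]
  rw [map_sum]
  simp only [map_smul, smul_eq_mul, pderiv]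
  simp [← h]

theorem norm_gradient_sq : ‖gradient f y‖ ^ 2 = ∑ i, pderiv i f y * pderiv i f y := by
  rw [EuclideanSpace.norm_sq_eq]
  refine Finset.sum_congr rfl fun i _ => ?_
  have h : (gradient f y) i = pderiv i f y := by
    have : inner ℝ (gradient f y) (EuclideanSpace.single i (1 : ℝ)) = pderiv i f y := by
      rw [gradient, InnerProductSpace.toDual_symm_apply, pderiv]
    rw [← this, EuclideanSpace.inner_single_right]; simp
  rw [h, Real.norm_eq_abs, sq_abs, sq]

theorem norm_fderiv_eq_norm_gradient : ‖fderiv ℝ f y‖ = ‖gradient f y‖ := by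
  rw [gradient, LinearIsometryEquiv.norm_map]

theorem laplacian_eq_sum_pderiv (hf : ContDiffAt ℝ 2 f y) :
    Laplacian.laplacian f y = ∑ i, pderiv i (pderiv i f) y := by
  rw [InnerProductSpace.laplacian_eq_iteratedFDeriv_orthonormalBasis f
    (EuclideanSpace.basisFun (Fin m) ℝ)]
  refine Finset.sum_congr rfl fun i _ => ?_
  have h1 : DifferentiableAt ℝ (fderiv ℝ f) y :=
    (hf.fderiv_right (m := 1) (by norm_num)).differentiableAt (by simp)
  rw [iteratedFDeriv_two_apply]
  simp only [pderiv]
  unfold pderiv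
  rw [fderiv_clm_apply h1 (by fun_prop)]
  simp

theorem pderiv_comm (hf : ContDiffAt ℝ 2 f y) (i j : Fin m) :
    pderiv i (pderiv j f) y = pderiv j (pderiv i f) y := by
  have h1 : DifferentiableAt ℝ (fderiv ℝ f) y :=
    (hf.fderiv_right (m := 1) (by norm_num)).differentiableAt (by simp)
  have key : ∀ i j : Fin m, pderiv i (pderiv j f) y =
      fderiv ℝ (fderiv ℝ f) y (EuclideanSpace.single i 1) (EuclideanSpace.single j 1) := by
    intro i j
    simp only [pderiv]
    unfold pderiv
    rw [fderiv_clm_apply h1 (by fun_prop)]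
    simp
  rw [key, key]
  exact (hf.isSymmSndFDerivAt (by simp)) _ _

theorem contDiffOn_pderiv {U : Set (EuclideanSpace ℝ (Fin m))} (hU : IsOpen U) {k l : ℕ}
    (hf : ContDiffOn ℝ k f U) (hkl : l + 1 ≤ k) : ContDiffOn ℝ l (pderiv i f) U :=
  (hf.fderiv_of_isOpen hU (by exact_mod_cast hkl)).clm_apply contDiffOn_const

theorem contDiffOn_laplacian {U : Set (EuclideanSpace ℝ (Fin m))} (hU : IsOpen U) {k l : ℕ}
    (hf : ContDiffOn ℝ k f U) (hkl : l + 2 ≤ k) :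
    ContDiffOn ℝ l (Laplacian.laplacian f) U := by
  have h : ContDiffOn ℝ l (fun y => ∑ i, pderiv i (pderiv i f) y) U :=
    ContDiffOn.sum fun i _ => contDiffOn_pderiv hU
      (contDiffOn_pderiv (l := l + 1) hU hf (by omega)) le_rfl
  refine h.congr fun y hy => laplacian_eq_sum_pderiv ?_
  exact (hf.contDiffAt (hU.mem_nhds hy)).of_le (by exact_mod_cast (by omega : 2 ≤ k))

theorem differentiableAt_pderiv (hf : ContDiffAt ℝ 2 f y) (i : Fin m) :
    DifferentiableAt ℝ (pderiv i f) y :=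
  ((hf.fderiv_right (m := 1) (by norm_num)).differentiableAt (by simp)).clm_apply
    (by fun_prop)

/-- The divergence of the field `f ∇f`. -/
theorem sum_pderiv_mul_pderiv (hf : ContDiffAt ℝ 2 f y) :
    ∑ i, pderiv i (fun z => f z * pderiv i f z) y =
      ‖gradient f y‖ ^ 2 + f y * Laplacian.laplacian f y := by
  rw [norm_gradient_sq, laplacian_eq_sum_pderiv hf, Finset.mul_sum, ← Finset.sum_add_distrib]
  refine Finset.sum_congr rfl fun i _ => ?_
  exact pderiv_mul (hf.differentiableAt (by simp)) (differentiableAt_pderiv hf i)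

/-- The divergence of the field `f y`. -/
theorem sum_pderiv_mul_coord (hf : DifferentiableAt ℝ f y) :
    ∑ i, pderiv i (fun z => f z * z i) y = m * f y + euler f y := by
  simp only [pderiv_mul hf (differentiableAt_coord _), pderiv_coord]
  rw [Finset.sum_add_distrib, euler_eq_sum]
  simp [mul_comm]
  ring

theorem differentiableAt_euler (hf : ContDiffAt ℝ 2 f y) : DifferentiableAt ℝ (euler f) y :=
  ((hf.fderiv_right (m := 1) (by norm_num)).differentiableAt (by simp)).clm_apply
    differentiableAt_id

theorem pderiv_euler (hf : ContDiffAt ℝ 2 f y) (i : Fin m) :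
    pderiv i (euler f) y = pderiv i f y + ∑ j, y j * pderiv i (pderiv j f) y := by
  have h : euler f = fun z => ∑ j, z j * pderiv j f z := funext fun z => euler_eq_sum
  rw [h, pderiv_sum fun j _ => (differentiableAt_coord j).fun_mul
    (differentiableAt_pderiv hf j)]
  simp only [pderiv_mul (differentiableAt_coord _) (differentiableAt_pderiv hf _),
    pderiv_coord, Finset.sum_add_distrib]
  simp

theorem pderiv_norm_gradient_sq (hf : ContDiffAt ℝ 2 f y) (i : Fin m) :
    pderiv i (fun z => ‖gradient f z‖ ^ 2) y =
      2 * ∑ j, pderiv i (pderiv j f) y * pderiv j f y := by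
  have hd := differentiableAt_pderiv hf
  simp only [norm_gradient_sq]
  rw [pderiv_sum fun j _ => (hd j).fun_mul (hd j), Finset.mul_sum]
  refine Finset.sum_congr rfl fun j _ => ?_
  rw [pderiv_mul (hd j) (hd j)]
  ring

/-- The Rellich identity in pointwise form: the divergence of `|∇f|² y - 2 (y · ∇f) ∇f`. -/
theorem sum_pderiv_rellich (hf : ContDiffAt ℝ 2 f y) :
    ∑ i, pderiv i (fun z => ‖gradient f z‖ ^ 2 * z i - 2 * euler f z * pderiv i f z) y =
      ((m : ℝ) - 2) * ‖gradient f y‖ ^ 2 - 2 * euler f y * Laplacian.laplacian f y := by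
  have hd := differentiableAt_pderiv hf
  have he := differentiableAt_euler hf
  have hn : DifferentiableAt ℝ (fun z => ‖gradient f z‖ ^ 2) y := by
    simp only [norm_gradient_sq]
    exact DifferentiableAt.fun_sum fun j _ => (hd j).fun_mul (hd j)
  have h2e : DifferentiableAt ℝ (fun z => 2 * euler f z) y := he.const_mul 2
  have h1 : ∀ i, pderiv i
      (fun z => ‖gradient f z‖ ^ 2 * z i - 2 * euler f z * pderiv i f z) y =
      pderiv i (fun z => ‖gradient f z‖ ^ 2 * z i) y -
        (2 * (pderiv i f y + ∑ j, y j * pderiv i (pderiv j f) y) * pderiv i f y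
          + 2 * euler f y * pderiv i (pderiv i f) y) := by
    intro i
    rw [pderiv_sub (hn.fun_mul (differentiableAt_coord i)) (h2e.fun_mul (hd i)),
      pderiv_mul h2e (hd i), pderiv_mul (by fun_prop) he, pderiv_const, pderiv_euler hf]
    ring
  rw [Finset.sum_congr rfl fun i _ => h1 i, Finset.sum_sub_distrib, sum_pderiv_mul_coord hn,
    euler_eq_sum, laplacian_eq_sum_pderiv hf, Finset.sum_add_distrib]
  simp only [pderiv_norm_gradient_sq hf]
  have h3 : ∑ i, y i * (2 * ∑ j, pderiv i (pderiv j f) y * pderiv j f y) =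
      ∑ i, 2 * (∑ j, y j * pderiv i (pderiv j f) y) * pderiv i f y := by
    simp only [Finset.mul_sum, Finset.sum_mul]
    rw [Finset.sum_comm]
    refine Finset.sum_congr rfl fun i _ => Finset.sum_congr rfl fun j _ => ?_
    rw [pderiv_comm hf]; ring
  have h4 : ∑ i, 2 * (pderiv i f y + ∑ j, y j * pderiv i (pderiv j f) y) * pderiv i f y =
      2 * ‖gradient f y‖ ^ 2 + ∑ i, 2 * (∑ j, y j * pderiv i (pderiv j f) y) * pderiv i f y := by
    rw [norm_gradient_sq, Finset.mul_sum, ← Finset.sum_add_distrib]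
    refine Finset.sum_congr rfl fun i _ => ?_
    ring
  rw [h3, h4, Finset.mul_sum]
  ring

/-- The divergence of the field `(c - |y|²) f ∇f`. -/
theorem sum_pderiv_sub_norm_sq_mul (hf : ContDiffAt ℝ 2 f y) (c : ℝ) :
    ∑ i, pderiv i (fun z => (c - ‖z‖ ^ 2) * (f z * pderiv i f z)) y =
      (c - ‖y‖ ^ 2) * (‖gradient f y‖ ^ 2 + f y * Laplacian.laplacian f y)
        - 2 * (f y * euler f y) := by
  have hd := differentiableAt_pderiv hf
  have hf1 : DifferentiableAt ℝ f y := hf.differentiableAt (by simp)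
  have hc : ∀ i, pderiv i (fun z => c - ‖z‖ ^ 2) y = - 2 * y i := by
    intro i
    have h := (hasStrictFDerivAt_norm_sq y).hasFDerivAt.const_sub c
    rw [pderiv, h.fderiv]
    simp [EuclideanSpace.inner_single_right]
  have hcd : DifferentiableAt ℝ (fun z : EuclideanSpace ℝ (Fin m) => c - ‖z‖ ^ 2) y :=
    ((hasStrictFDerivAt_norm_sq y).hasFDerivAt.const_sub c).differentiableAt
  rw [← sum_pderiv_mul_pderiv hf, euler_eq_sum, Finset.mul_sum, Finset.mul_sum, Finset.mul_sum,
    ← Finset.sum_sub_distrib]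
  refine Finset.sum_congr rfl fun i _ => ?_
  rw [pderiv_mul hcd (hf1.fun_mul (hd i)), hc]
  ring

end Coordinates

/-! ### The lift to one more variable -/

section Lift

variable {n : ℕ}

/-- The projection `(x, x_{n+1}) ↦ x` as a continuous linear map. -/
noncomputable def spacePartCLM (n : ℕ) :
    EuclideanSpace ℝ (Fin (n + 1)) →L[ℝ] EuclideanSpace ℝ (Fin n) :=
  ((EuclideanSpace.equiv (Fin n) ℝ).symm : (Fin n → ℝ) →L[ℝ] EuclideanSpace ℝ (Fin n)).comp
    (ContinuousLinearMap.pi fun i => EuclideanSpace.proj i.castSucc)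

theorem coe_spacePartCLM : ⇑(spacePartCLM n) = spacePart := rfl

theorem spacePart_single_castSucc (i : Fin n) :
    spacePart (EuclideanSpace.single i.castSucc (1 : ℝ)) = EuclideanSpace.single i 1 := by
  ext j; simp [spacePart]

theorem spacePart_single_last :
    spacePart (EuclideanSpace.single (Fin.last n) (1 : ℝ)) = 0 := by
  ext j; simp [spacePart]

variable {lam : ℝ} {w : EuclideanSpace ℝ (Fin n) → ℝ} {y : EuclideanSpace ℝ (Fin (n + 1))}

theorem hasFDerivAt_lift (hw : DifferentiableAt ℝ w (spacePart y)) :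
    HasFDerivAt (lift lam w)
      (w (spacePart y) • (Real.exp (Real.sqrt lam * lastPart y) •
          (Real.sqrt lam • (EuclideanSpace.proj (Fin.last n) :
            EuclideanSpace ℝ (Fin (n + 1)) →L[ℝ] ℝ))) +
        Real.exp (Real.sqrt lam * lastPart y) •
          (fderiv ℝ w (spacePart y)).comp (spacePartCLM n)) y := by
  have h1 : HasFDerivAt (fun y => w (spacePart y))
      ((fderiv ℝ w (spacePart y)).comp (spacePartCLM n)) y := by
    have h : HasFDerivAt spacePart (spacePartCLM n) y := (spacePartCLM n).hasFDerivAt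
    exact hw.hasFDerivAt.comp y h
  have h2 : HasFDerivAt (fun y : EuclideanSpace ℝ (Fin (n + 1)) => Real.sqrt lam * lastPart y)
      (Real.sqrt lam • (EuclideanSpace.proj (Fin.last n) :
        EuclideanSpace ℝ (Fin (n + 1)) →L[ℝ] ℝ)) y := by
    have h : HasFDerivAt (lastPart (n := n)) (EuclideanSpace.proj (Fin.last n) :
        EuclideanSpace ℝ (Fin (n + 1)) →L[ℝ] ℝ) y :=
      (EuclideanSpace.proj (Fin.last n) : EuclideanSpace ℝ (Fin (n + 1)) →L[ℝ] ℝ).hasFDerivAt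
    exact h.const_mul _
  exact h1.mul h2.exp

theorem pderiv_castSucc_lift (hw : DifferentiableAt ℝ w (spacePart y)) (i : Fin n) :
    pderiv i.castSucc (lift lam w) y = lift lam (pderiv i w) y := by
  rw [pderiv, (hasFDerivAt_lift hw).fderiv]
  simp [coe_spacePartCLM, spacePart_single_castSucc, lift, pderiv,
    (Fin.castSucc_lt_last i).ne']
  ring

theorem pderiv_last_lift (hw : DifferentiableAt ℝ w (spacePart y)) :
    pderiv (Fin.last n) (lift lam w) y = Real.sqrt lam * lift lam w y := by
  rw [pderiv, (hasFDerivAt_lift hw).fderiv]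
  simp [coe_spacePartCLM, spacePart_single_last, lift]
  ring

theorem contDiffOn_lift {Ω : Set (EuclideanSpace ℝ (Fin n))} {k : ℕ} (hw : ContDiffOn ℝ k w Ω) :
    ContDiffOn ℝ k (lift lam w) (spacePart ⁻¹' Ω) := by
  have h1 : ContDiff ℝ k (spacePart (n := n)) := (spacePartCLM n).contDiff
  have h2 : ContDiff ℝ k (lastPart (n := n)) :=
    (EuclideanSpace.proj (Fin.last n) : EuclideanSpace ℝ (Fin (n + 1)) →L[ℝ] ℝ).contDiff
  exact (hw.comp h1.contDiffOn (mapsTo_preimage _ _)).mul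
    ((contDiff_const.mul h2).exp).contDiffOn

theorem isOpen_preimage_spacePart {Ω : Set (EuclideanSpace ℝ (Fin n))} (hΩ : IsOpen Ω) :
    IsOpen (spacePart ⁻¹' Ω) :=
  hΩ.preimage (spacePartCLM n).continuous

/-- The extra variable contributes `lam` to the Laplacian. -/
theorem laplacian_lift {Ω : Set (EuclideanSpace ℝ (Fin n))} (hΩ : IsOpen Ω)
    (hw : ContDiffOn ℝ 2 w Ω) (hlam : 0 ≤ lam) (hy : spacePart y ∈ Ω) :
    Laplacian.laplacian (lift lam w) y =
      lift lam (Laplacian.laplacian w) y + lam * lift lam w y := by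
  have hU := isOpen_preimage_spacePart hΩ
  have hd : ∀ z ∈ spacePart ⁻¹' Ω, DifferentiableAt ℝ w (spacePart z) := fun z hz =>
    (hw.differentiableOn (by simp)).differentiableAt (hΩ.mem_nhds hz)
  have hwy : ContDiffAt ℝ 2 w (spacePart y) := hw.contDiffAt (hΩ.mem_nhds hy)
  rw [laplacian_eq_sum_pderiv ((contDiffOn_lift (k := 2) hw).contDiffAt (hU.mem_nhds hy)),
    Fin.sum_univ_castSucc]
  congr 1
  · have h1 : ∀ i : Fin n, pderiv i.castSucc (pderiv i.castSucc (lift lam w)) y =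
        lift lam (pderiv i (pderiv i w)) y := by
      intro i
      rw [← pderiv_castSucc_lift (differentiableAt_pderiv hwy i)]
      refine pderiv_congr ?_
      filter_upwards [hU.mem_nhds hy] with z hz using pderiv_castSucc_lift (hd z hz) i
    simp only [h1, lift, laplacian_eq_sum_pderiv hwy, Finset.sum_mul]
  · have h1 : pderiv (Fin.last n) (pderiv (Fin.last n) (lift lam w)) y =
        pderiv (Fin.last n) (fun z => Real.sqrt lam * lift lam w z) y := by
      refine pderiv_congr ?_
      filter_upwards [hU.mem_nhds hy] with z hz using pderiv_last_lift (hd z hz)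
    rw [h1, pderiv_mul (by fun_prop) (hasFDerivAt_lift (hd y hy)).differentiableAt,
      pderiv_const, pderiv_last_lift (hd y hy), zero_mul, zero_add, ← mul_assoc,
      Real.mul_self_sqrt hlam]

variable {Ω : Set (EuclideanSpace ℝ (Fin n))} {u : EuclideanSpace ℝ (Fin n) → ℝ}

theorem IsEigenfunctionOn.contDiffOn_vFun (hΩ : IsOpen Ω) (hu : IsEigenfunctionOn Ω lam u) :
    ContDiffOn ℝ 2 (vFun lam u) Ω :=
  (contDiffOn_laplacian (k := 4) (l := 2) hΩ hu.1 le_rfl).sub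
    (contDiffOn_const.mul (hu.1.of_le (by norm_num)))

theorem IsEigenfunctionOn.laplacian_gFun (hΩ : IsOpen Ω) (hu : IsEigenfunctionOn Ω lam u)
    (hlam : 0 ≤ lam) (hy : spacePart y ∈ Ω) :
    Laplacian.laplacian (gFun lam u) y = 2 * lam * gFun lam u y + hFun lam u y := by
  rw [gFun, laplacian_lift hΩ (hu.1.of_le (by norm_num)) hlam hy]
  simp only [hFun, lift, vFun]
  ring

theorem IsEigenfunctionOn.laplacian_hFun (hΩ : IsOpen Ω) (hu : IsEigenfunctionOn Ω lam u)
    (hlam : 0 ≤ lam) (hy : spacePart y ∈ Ω) :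
    Laplacian.laplacian (hFun lam u) y = 0 := by
  rw [hFun, laplacian_lift hΩ (hu.contDiffOn_vFun hΩ) hlam hy]
  have hx := hΩ.mem_nhds hy
  have h1 : ContDiffAt ℝ 2 (Laplacian.laplacian u) (spacePart y) :=
    (contDiffOn_laplacian (k := 4) (l := 2) hΩ hu.1 le_rfl).contDiffAt hx
  have h2 : ContDiffAt ℝ 2 u (spacePart y) := (hu.1.contDiffAt hx).of_le (by norm_num)
  have h3 : vFun lam u = Laplacian.laplacian u - lam • u := rfl
  have h4 : Laplacian.laplacian (vFun lam u) (spacePart y) = -lam * vFun lam u (spacePart y) := by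
    rw [h3, h1.laplacian_sub (f₂ := lam • u) (h2.const_smul lam),
      InnerProductSpace.laplacian_smul lam h2, hu.2 _ hy]
    simp
    ring
  simp only [lift, h4]
  ring

end Lift

/-! ### Integral identities on balls and spheres -/

section SurfaceMeasure

variable {n : ℕ} {f f₁ f₂ : EuclideanSpace ℝ (Fin (n + 1)) → ℝ} {r R : ℝ}

theorem measurableEmbedding_add_smul_sphere (y₀ : EuclideanSpace ℝ (Fin (n + 1))) (hr : 0 < r) :
    MeasurableEmbedding (fun ω : sphere (0 : EuclideanSpace ℝ (Fin (n + 1))) 1 =>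
      y₀ + r • (ω : EuclideanSpace ℝ (Fin (n + 1)))) :=
  ((Homeomorph.addLeft y₀).measurableEmbedding.comp
    (Homeomorph.smulOfNeZero r hr.ne').measurableEmbedding).comp
    (MeasurableEmbedding.subtype_coe isClosed_sphere.measurableSet)

/-- The embedding `ω ↦ y₀ + r ω` is measurable, so no regularity of `f` is needed. -/
theorem integral_surfaceMeasure (y₀ : EuclideanSpace ℝ (Fin (n + 1))) (hr : 0 < r)
    (f : EuclideanSpace ℝ (Fin (n + 1)) → ℝ) :
    ∫ y, f y ∂surfaceMeasure y₀ r =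
      r ^ n * ∫ ω : sphere (0 : EuclideanSpace ℝ (Fin (n + 1))) 1, f (y₀ + r • (ω : _))
        ∂(volume : Measure (EuclideanSpace ℝ (Fin (n + 1)))).toSphere := by
  rw [surfaceMeasure, integral_smul_measure,
    (measurableEmbedding_add_smul_sphere y₀ hr).integral_map, smul_eq_mul,
    ENNReal.toReal_ofReal (by positivity)]

theorem integral_surfaceMeasure_zero (hr : 0 < r) (f : EuclideanSpace ℝ (Fin (n + 1)) → ℝ) :
    ∫ y, f y ∂surfaceMeasure 0 r =
      r ^ n * ∫ ω : sphere (0 : EuclideanSpace ℝ (Fin (n + 1))) 1, f (r • (ω : _))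
        ∂(volume : Measure (EuclideanSpace ℝ (Fin (n + 1)))).toSphere := by
  simp [integral_surfaceMeasure 0 hr]

theorem integrable_surfaceMeasure_zero (hr : 0 < r) (hrR : r < R)
    (hf : ContinuousOn f (ball 0 R)) : Integrable f (surfaceMeasure 0 r) := by
  rw [surfaceMeasure]
  refine Integrable.smul_measure ?_ (by simp)
  rw [(measurableEmbedding_add_smul_sphere 0 hr).integrable_map_iff]
  simpa [Function.comp_def] using integrable_toSphere volume hf ⟨by linarith, hrR⟩

/-- Functions that agree on the sphere of radius `r` have the same surface integral. -/
theorem integral_surfaceMeasure_zero_congr (hr : 0 < r) (h : ∀ y, ‖y‖ = r → f₁ y = f₂ y) :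
    ∫ y, f₁ y ∂surfaceMeasure 0 r = ∫ y, f₂ y ∂surfaceMeasure 0 r := by
  rw [integral_surfaceMeasure_zero hr, integral_surfaceMeasure_zero hr]
  congr 2; funext ω
  exact h _ (by simp [norm_smul, abs_of_pos hr])

/-- The divergence theorem on a ball centred at the origin, for the field with components `F i`;
the factor `r` replaces the division in the outer normal `y / r`. -/
theorem mul_setIntegral_ball_divergence {F : Fin (n + 1) → EuclideanSpace ℝ (Fin (n + 1)) → ℝ}
    (hr : 0 < r) (hrR : r < R) (hF : ∀ i, ContDiffOn ℝ 1 (F i) (ball 0 R)) :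
    r * ∫ y in ball 0 r, ∑ i, pderiv i (F i) y =
      ∫ y, ∑ i, F i y * y i ∂surfaceMeasure 0 r := by
  rw [integral_finsetSum, integral_finsetSum, Finset.mul_sum]
  · refine Finset.sum_congr rfl fun i _ => ?_
    have h := setIntegral_ball_fderiv_eq_integral_toSphere volume hr hrR (hF i)
      (EuclideanSpace.single i 1)
    simp only [pderiv, h, integral_surfaceMeasure_zero hr]
    rw [finrank_euclideanSpace_fin, Nat.add_sub_cancel, mul_left_comm, ← integral_const_mul]
    congr 2; funext ω
    simp [EuclideanSpace.inner_single_right]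
    ring
  · intro i _
    exact integrable_surfaceMeasure_zero hr hrR ((hF i).continuousOn.mul (by fun_prop))
  · intro i _
    exact integrableOn_ball_of_continuousOn volume
      (((hF i).continuousOn_fderiv_of_isOpen isOpen_ball le_rfl).clm_apply continuousOn_const) hrR

theorem hasDerivAt_integral_surfaceMeasure (hr : 0 < r) (hrR : r < R)
    (hf : ContDiffOn ℝ 1 f (ball 0 R)) :
    HasDerivAt (fun s => ∫ y, f y ∂surfaceMeasure 0 s)
      (n / r * ∫ y, f y ∂surfaceMeasure 0 r + r⁻¹ * ∫ y, euler f y ∂surfaceMeasure 0 r) r := by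
  have h := (hasDerivAt_pow n r).mul
    (hasDerivAt_integral_toSphere volume hf (r := r) ⟨by linarith, hrR⟩)
  have h' := h.congr_of_eventuallyEq (f₁ := fun s => ∫ y, f y ∂surfaceMeasure 0 s) (by
    filter_upwards [lt_mem_nhds hr] with s hs using integral_surfaceMeasure_zero hs f)
  refine h'.congr_deriv ?_
  rw [integral_surfaceMeasure_zero hr, integral_surfaceMeasure_zero hr]
  simp only [euler, map_smul, smul_eq_mul]
  rw [integral_const_mul]
  -- The exponent `n - 1` is truncated at `n = 0`.
  rcases n with _ | n
  · field_simp; simp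
  · field_simp; simp; ring

theorem hasDerivAt_setIntegral_ball_surfaceMeasure (hr : 0 < r) (hrR : r < R)
    (hf : ContinuousOn f (ball 0 R)) :
    HasDerivAt (fun s => ∫ y in ball 0 s, f y) (∫ y, f y ∂surfaceMeasure 0 r) r := by
  have h := hasDerivAt_setIntegral_ball volume hf hr hrR
  rwa [finrank_euclideanSpace_fin, Nat.add_sub_cancel, ← integral_surfaceMeasure_zero hr] at h

end SurfaceMeasure

section Identities

variable {n : ℕ} {f : EuclideanSpace ℝ (Fin (n + 1)) → ℝ} {r R : ℝ}

theorem contDiffOn_euler {U : Set (EuclideanSpace ℝ (Fin n))} (hU : IsOpen U)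
    {f : EuclideanSpace ℝ (Fin n) → ℝ} (hf : ContDiffOn ℝ 2 f U) : ContDiffOn ℝ 1 (euler f) U :=
  (hf.fderiv_of_isOpen hU (by norm_num)).clm_apply contDiffOn_id

theorem contDiffOn_norm_gradient_sq {U : Set (EuclideanSpace ℝ (Fin n))} (hU : IsOpen U)
    {f : EuclideanSpace ℝ (Fin n) → ℝ} (hf : ContDiffOn ℝ 2 f U) :
    ContDiffOn ℝ 1 (fun y => ‖gradient f y‖ ^ 2) U := by
  simp only [norm_gradient_sq]
  have h : ∀ i, ContDiffOn ℝ 1 (pderiv i f) U := fun i =>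
    contDiffOn_pderiv (k := 2) (l := 1) hU hf le_rfl
  exact ContDiffOn.sum fun i _ => (h i).mul (h i)

/-- Green's identity on a ball: the divergence theorem for the field `f ∇f`. -/
theorem mul_setIntegral_norm_gradient_sq_add (hr : 0 < r) (hrR : r < R)
    (hf : ContDiffOn ℝ 2 f (ball 0 R)) :
    r * ∫ y in ball 0 r, (‖gradient f y‖ ^ 2 + f y * Laplacian.laplacian f y) =
      ∫ y, f y * euler f y ∂surfaceMeasure 0 r := by
  have hp : ∀ i, ContDiffOn ℝ 1 (pderiv i f) (ball 0 R) := fun i =>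
    contDiffOn_pderiv (k := 2) (l := 1) isOpen_ball hf le_rfl
  have h := mul_setIntegral_ball_divergence (F := fun i z => f z * pderiv i f z) hr hrR
    fun i => (hf.of_le (by norm_num)).mul (hp i)
  convert h using 1
  · congr 1
    refine setIntegral_congr_fun measurableSet_ball fun y hy => ?_
    exact (sum_pderiv_mul_pderiv
      (hf.contDiffAt (isOpen_ball.mem_nhds (ball_subset_ball hrR.le hy)))).symm
  · congr 1; funext y
    rw [euler_eq_sum, Finset.mul_sum]
    exact Finset.sum_congr rfl fun i _ => by ring

/-- The Rellich identity on a ball. -/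
theorem mul_setIntegral_rellich (hr : 0 < r) (hrR : r < R)
    (hf : ContDiffOn ℝ 2 f (ball 0 R)) :
    r * ∫ y in ball 0 r, (((n : ℝ) - 1) * ‖gradient f y‖ ^ 2
        - 2 * euler f y * Laplacian.laplacian f y) =
      ∫ y, (r ^ 2 * ‖gradient f y‖ ^ 2 - 2 * euler f y ^ 2) ∂surfaceMeasure 0 r := by
  have hp : ∀ i, ContDiffOn ℝ 1 (pderiv i f) (ball 0 R) := fun i =>
    contDiffOn_pderiv (k := 2) (l := 1) isOpen_ball hf le_rfl
  have h := mul_setIntegral_ball_divergence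
    (F := fun i z => ‖gradient f z‖ ^ 2 * z i - 2 * euler f z * pderiv i f z) hr hrR
    fun i => ((contDiffOn_norm_gradient_sq isOpen_ball hf).mul (by fun_prop)).sub
      ((contDiffOn_const.mul (contDiffOn_euler isOpen_ball hf)).mul (hp i))
  rw [setIntegral_congr_fun (g := fun y => ((n : ℝ) - 1) * ‖gradient f y‖ ^ 2
        - 2 * euler f y * Laplacian.laplacian f y) measurableSet_ball fun y hy => by
      simp only [sum_pderiv_rellich
        (hf.contDiffAt (isOpen_ball.mem_nhds (ball_subset_ball hrR.le hy)))]
      push_cast; ring] at h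
  rw [h]
  refine integral_surfaceMeasure_zero_congr hr fun y hy => ?_
  have hn : r ^ 2 = ∑ i, y i * y i := by
    rw [← hy, EuclideanSpace.norm_sq_eq]
    exact Finset.sum_congr rfl fun i _ => by rw [Real.norm_eq_abs, sq_abs, sq]
  calc ∑ i, (‖gradient f y‖ ^ 2 * y i - 2 * euler f y * pderiv i f y) * y i
      = ∑ i, (‖gradient f y‖ ^ 2 * (y i * y i) - 2 * euler f y * (y i * pderiv i f y)) :=
        Finset.sum_congr rfl fun i _ => by ring
    _ = ‖gradient f y‖ ^ 2 * r ^ 2 - 2 * euler f y * euler f y := by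
        rw [Finset.sum_sub_distrib, ← Finset.mul_sum, ← Finset.mul_sum, ← hn, ← euler_eq_sum]
    _ = _ := by ring

/-- The divergence theorem on a ball for the field `f² y`. -/
theorem mul_setIntegral_sq_add (hr : 0 < r) (hrR : r < R)
    (hf : ContDiffOn ℝ 2 f (ball 0 R)) :
    r * ∫ y in ball 0 r, (((n : ℝ) + 1) * f y ^ 2 + 2 * (f y * euler f y)) =
      ∫ y, r ^ 2 * f y ^ 2 ∂surfaceMeasure 0 r := by
  have hf1 : ContDiffOn ℝ 1 (fun y => f y * f y) (ball 0 R) :=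
    (hf.mul hf).of_le (by norm_num)
  have h := mul_setIntegral_ball_divergence (F := fun i z => (f z * f z) * z i) hr hrR
    fun i => hf1.mul (by fun_prop)
  rw [setIntegral_congr_fun (g := fun y => ((n : ℝ) + 1) * f y ^ 2 + 2 * (f y * euler f y))
    measurableSet_ball fun y hy => by
      have hd : ContDiffAt ℝ 2 f y :=
        hf.contDiffAt (isOpen_ball.mem_nhds (ball_subset_ball hrR.le hy))
      have hd1 : DifferentiableAt ℝ f y := hd.differentiableAt (by simp)
      simp only [sum_pderiv_mul_coord (hd1.fun_mul hd1)]
      rw [euler, fderiv_fun_mul hd1 hd1]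
      simp [euler]; ring] at h
  rw [h]
  refine integral_surfaceMeasure_zero_congr hr fun y hy => ?_
  rw [← hy, EuclideanSpace.norm_sq_eq, Finset.sum_mul]
  refine Finset.sum_congr rfl fun i _ => ?_
  simp only [Real.norm_eq_abs, sq_abs]; ring

/-- The square of a harmonic function is subharmonic, so its integral over a ball is controlled by
the one over the sphere. -/
theorem setIntegral_ball_sq_le_of_harmonic (hr : 0 < r) (hrR : r < R)
    (hf : ContDiffOn ℝ 2 f (ball 0 R))
    (hΔ : ∀ y ∈ ball (0 : EuclideanSpace ℝ (Fin (n + 1))) R, Laplacian.laplacian f y = 0) :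
    (n + 1) * ∫ y in ball 0 r, f y ^ 2 ≤ r * ∫ y, f y ^ 2 ∂surfaceMeasure 0 r := by
  have hp : ∀ i, ContDiffOn ℝ 1 (pderiv i f) (ball 0 R) := fun i =>
    contDiffOn_pderiv (k := 2) (l := 1) isOpen_ball hf le_rfl
  have hI : ∀ {k : EuclideanSpace ℝ (Fin (n + 1)) → ℝ}, ContinuousOn k (ball 0 R) →
      Integrable k (volume.restrict (ball 0 r)) := fun hk =>
    integrableOn_ball_of_continuousOn volume hk hrR
  have hf1 : ContDiffOn ℝ 1 f (ball 0 R) := hf.of_le (by norm_num)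
  have hfc := hf.continuousOn
  have hec : ContinuousOn (euler f) (ball 0 R) := (contDiffOn_euler isOpen_ball hf).continuousOn
  have hgc := (contDiffOn_norm_gradient_sq isOpen_ball hf).continuousOn
  have h := mul_setIntegral_ball_divergence
    (F := fun i z => (r ^ 2 - ‖z‖ ^ 2) * (f z * pderiv i f z)) hr hrR
    fun i => (contDiff_const.sub (contDiff_norm_sq ℝ)).contDiffOn.mul (hf1.mul (hp i))
  rw [setIntegral_congr_fun (g := fun y => (r ^ 2 - ‖y‖ ^ 2) * ‖gradient f y‖ ^ 2
        - 2 * (f y * euler f y)) measurableSet_ball fun y hy => by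
      have hy' := ball_subset_ball hrR.le hy
      simp only [sum_pderiv_sub_norm_sq_mul (hf.contDiffAt (isOpen_ball.mem_nhds hy')), hΔ y hy']
      ring,
    integral_surfaceMeasure_zero_congr (f₂ := fun _ => 0) hr fun y hy => by simp [hy],
    integral_zero, integral_sub (hI (by fun_prop)) (hI (by fun_prop))] at h
  -- The field `(r² - |y|²) f ∇f` vanishes on the sphere, whence `2 ∫ f (y · ∇f) ≥ 0`.
  have hpos : 0 ≤ ∫ y in ball 0 r, (r ^ 2 - ‖y‖ ^ 2) * ‖gradient f y‖ ^ 2 := by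
    refine setIntegral_nonneg measurableSet_ball fun y hy => mul_nonneg ?_ (sq_nonneg _)
    have : ‖y‖ < r := by simpa using hy
    nlinarith [norm_nonneg y]
  have h2 := mul_setIntegral_sq_add hr hrR hf
  rw [integral_add (hI (by fun_prop)) (hI (by fun_prop)), integral_const_mul,
    integral_const_mul (r ^ 2)] at h2
  have h3 : 0 ≤ ∫ y in ball 0 r, 2 * (f y * euler f y) := by
    rcases mul_eq_zero.1 h with h | h <;> linarith
  nlinarith

end Identities

/-! ### Almost monotonicity for the second order system -/

section Frequency

theorem abs_euler_le {m : ℕ} (f : EuclideanSpace ℝ (Fin m) → ℝ) (y : EuclideanSpace ℝ (Fin m)) :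
    |euler f y| ≤ ‖y‖ * ‖gradient f y‖ := by
  have h := (fderiv ℝ f y).le_opNorm y
  rwa [norm_fderiv_eq_norm_gradient, mul_comm] at h

/-- The algebra behind the lower bound of the logarithmic derivative `1 / r + D' / D - H' / H`. -/
theorem neg_le_logDeriv_of_bounds {n : ℕ} {r D D' H P Q K : ℝ} (hr : 0 < r) (hr1 : r ≤ 1)
    (hH : 0 ≤ H)
    (hN : 1 ≤ r * (D / H)) (hP : r * D = P) (hPQ : P ^ 2 ≤ H * Q)
    (hD' : 2 * Q + r * ((n - 1) * D) + r * K ≤ r ^ 2 * D' + r ^ 2 * H / 2)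
    (hK : -(r * D) - (n ^ 2 + 2) * (r * H) ≤ K) :
    -((n : ℝ) ^ 2 + 4) ≤ 1 / r + D' / D - (n / r * H + 2 * D) / H := by
  have hH0 : 0 < H := by
    rcases hH.eq_or_lt with h | h
    · rw [← h] at hN; simp at hN; linarith
    · exact h
  have hHD : H ≤ r * D := by
    rwa [← mul_div_assoc, le_div_iff₀ hH0, one_mul] at hN
  have hD0 : 0 < D := by
    by_contra hcon
    nlinarith
  have hHD1 : H ≤ D := hHD.trans (by nlinarith)
  -- The Cauchy-Schwarz inequality, divided by `H`.
  have hQ : r ^ 2 * D ^ 2 / H ≤ Q := by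
    rw [div_le_iff₀ hH0]
    calc r ^ 2 * D ^ 2 = P ^ 2 := by rw [← hP]; ring
      _ ≤ H * Q := hPQ
      _ = Q * H := mul_comm _ _
  have hn : (0 : ℝ) ≤ (n : ℝ) ^ 2 + 2 := by positivity
  have hD2 : 2 * D ^ 2 / H + (n - 1) / r * D - ((n : ℝ) ^ 2 + 4) * D ≤ D' := by
    have h1 : r ^ 2 * (2 * D ^ 2 / H + (n - 1) / r * D - ((n : ℝ) ^ 2 + 4) * D) ≤ r ^ 2 * D' := by
      have e1 : r ^ 2 * (2 * D ^ 2 / H + (n - 1) / r * D - ((n : ℝ) ^ 2 + 4) * D) =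
          2 * (r ^ 2 * D ^ 2 / H) + r * ((n - 1) * D) - r ^ 2 * (((n : ℝ) ^ 2 + 4) * D) := by
        field_simp
      rw [e1]
      have h2 : r * (-(r * D) - (n ^ 2 + 2) * (r * H)) ≤ r * K :=
        mul_le_mul_of_nonneg_left hK hr.le
      have h3 : ((n : ℝ) ^ 2 + 2) * H ≤ ((n : ℝ) ^ 2 + 2) * D :=
        mul_le_mul_of_nonneg_left hHD1 hn
      have h4 : 0 ≤ r ^ 2 * (((n : ℝ) ^ 2 + 4) * D - D - ((n : ℝ) ^ 2 + 2) * H - H / 2) := by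
        apply mul_nonneg (by positivity)
        nlinarith
      nlinarith
    exact le_of_mul_le_mul_left h1 (by positivity)
  have h5 : 2 * D / H + (n - 1) / r - ((n : ℝ) ^ 2 + 4) ≤ D' / D := by
    rw [le_div_iff₀ hD0]
    refine le_trans (le_of_eq ?_) hD2
    field_simp
  have h6 : (n / r * H + 2 * D) / H = n / r + 2 * D / H := by field_simp
  have h7 : ((n : ℝ) - 1) / r = n / r - 1 / r := by ring
  rw [h6]
  linarith

/-- The terms by which the divergence of the Rellich field of the pair `(g, h)` differs from
`n - 1` times the energy density are bounded below by the energy density and `h²`. Here `a`, `b`,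
`x` stand for `|∇g|`, `|∇h|` and `y · ∇g`, and `4 lam g²` absorbs the product `g h`. -/
theorem neg_energyDensity_sub_le {n : ℕ} {r lam a b g h x : ℝ} (hlam : 1 < lam) (hr : 0 < r)
    (hr1 : r ≤ 1) (hx : |x| ≤ r * a) :
    -r * (a ^ 2 + b ^ 2 + g * h + 2 * lam * g ^ 2) - (n ^ 2 + 2) * h ^ 2 ≤
      4 * lam * g ^ 2 - (n - 1) * (g * h) - 2 * (x * h) := by
  have h0 : g ^ 2 ≤ lam * g ^ 2 := le_mul_of_one_le_left (sq_nonneg g) hlam.le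
  have h3 : 2 * (x * h) ≤ r * (a ^ 2 + h ^ 2) := by
    calc 2 * (x * h) ≤ 2 * (|x| * |h|) := by
          rw [← abs_mul]; linarith [le_abs_self (x * h)]
      _ ≤ 2 * (r * a * |h|) := by gcongr
      _ = r * (2 * a * |h|) := by ring
      _ ≤ r * (a ^ 2 + |h| ^ 2) := by gcongr; exact two_mul_le_add_sq a |h|
      _ = _ := by rw [sq_abs]
  have h4 : a ^ 2 ≤ a ^ 2 + b ^ 2 + g * h + 2 * lam * g ^ 2 + h ^ 2 / 8 := by
    have e1 : 2 * (g + h / 4) ^ 2 = 2 * g ^ 2 + g * h + h ^ 2 / 8 := by ring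
    linarith [sq_nonneg b, sq_nonneg (g + h / 4)]
  have h5 : (n - 1) * (g * h) ≤ 4 * lam * g ^ 2 + ((n : ℝ) ^ 2 + 1) / 8 * h ^ 2 := by
    have e1 : (2 * g - (n - 1) * h / 4) ^ 2 + ((n + 1) * h / 4) ^ 2 =
        4 * g ^ 2 - (n - 1) * (g * h) + ((n : ℝ) ^ 2 + 1) / 8 * h ^ 2 := by ring
    linarith [sq_nonneg (2 * g - (n - 1) * h / 4), sq_nonneg ((n + 1) * h / 4)]
  have h6 := mul_le_mul_of_nonneg_left h4 hr.le
  have h7 : r * h ^ 2 ≤ h ^ 2 := mul_le_of_le_one_left (sq_nonneg h) hr1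
  have h8 : 0 ≤ (n : ℝ) ^ 2 * h ^ 2 := by positivity
  have h9 := sq_nonneg h
  linarith

/-- The density `|∇g|² + |∇h|² + g h + 2 lam g²` of the numerator of the frequency. -/
noncomputable def energyDensity {m : ℕ} (lam : ℝ) (g h : EuclideanSpace ℝ (Fin m) → ℝ)
    (y : EuclideanSpace ℝ (Fin m)) : ℝ :=
  ‖gradient g y‖ ^ 2 + ‖gradient h y‖ ^ 2 + g y * h y + 2 * lam * g y ^ 2

variable {n : ℕ} {g h : EuclideanSpace ℝ (Fin (n + 1)) → ℝ} {r R lam : ℝ}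

theorem continuousOn_energyDensity (hg : ContDiffOn ℝ 2 g (ball 0 R))
    (hh : ContDiffOn ℝ 2 h (ball 0 R)) : ContinuousOn (energyDensity lam g h) (ball 0 R) := by
  have hgc := hg.continuousOn
  have hhc := hh.continuousOn
  have hgg := (contDiffOn_norm_gradient_sq isOpen_ball hg).continuousOn
  have hgh := (contDiffOn_norm_gradient_sq isOpen_ball hh).continuousOn
  unfold energyDensity
  fun_prop

/-- The energy density is the divergence of `g ∇g + h ∇h`, so its integral over the ball is a
boundary integral. -/
theorem mul_setIntegral_energyDensity (hr : 0 < r) (hrR : r < R)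
    (hg : ContDiffOn ℝ 2 g (ball 0 R)) (hh : ContDiffOn ℝ 2 h (ball 0 R))
    (hΔg : ∀ y ∈ ball (0 : EuclideanSpace ℝ (Fin (n + 1))) R,
      Laplacian.laplacian g y = 2 * lam * g y + h y)
    (hΔh : ∀ y ∈ ball (0 : EuclideanSpace ℝ (Fin (n + 1))) R, Laplacian.laplacian h y = 0) :
    r * ∫ y in ball 0 r, energyDensity lam g h y =
      ∫ y, (g y * euler g y + h y * euler h y) ∂surfaceMeasure 0 r := by
  have hgc := hg.continuousOn
  have hhc := hh.continuousOn
  have hgg := (contDiffOn_norm_gradient_sq isOpen_ball hg).continuousOn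
  have hgh := (contDiffOn_norm_gradient_sq isOpen_ball hh).continuousOn
  have heg := (contDiffOn_euler isOpen_ball hg).continuousOn
  have heh := (contDiffOn_euler isOpen_ball hh).continuousOn
  have hB : ∀ {k : EuclideanSpace ℝ (Fin (n + 1)) → ℝ}, ContinuousOn k (ball 0 R) →
      Integrable k (volume.restrict (ball 0 r)) := fun hk =>
    integrableOn_ball_of_continuousOn volume hk hrR
  have hS : ∀ {k : EuclideanSpace ℝ (Fin (n + 1)) → ℝ}, ContinuousOn k (ball 0 R) →
      Integrable k (surfaceMeasure 0 r) := fun hk => integrable_surfaceMeasure_zero hr hrR hk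
  have hsub : ∀ {y : EuclideanSpace ℝ (Fin (n + 1))}, y ∈ ball 0 r → y ∈ ball 0 R :=
    fun hy => ball_subset_ball hrR.le hy
  have h1 := mul_setIntegral_norm_gradient_sq_add hr hrR hg
  have h2 := mul_setIntegral_norm_gradient_sq_add hr hrR hh
  rw [setIntegral_congr_fun (g := fun y => ‖gradient g y‖ ^ 2 + g y * (2 * lam * g y + h y))
      measurableSet_ball fun y hy => by simp only [hΔg y (hsub hy)]] at h1
  rw [setIntegral_congr_fun (g := fun y => ‖gradient h y‖ ^ 2)
      measurableSet_ball fun y hy => by simp only [hΔh y (hsub hy)]; ring] at h2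
  rw [integral_add (hS (by fun_prop)) (hS (by fun_prop)), ← h1, ← h2, ← mul_add,
    ← integral_add (hB (by fun_prop)) (hB (by fun_prop))]
  congr 1
  refine integral_congr_ae (.of_forall fun y => ?_)
  simp only [energyDensity]; ring

/-- The Cauchy-Schwarz inequality for the pairs `(g, h)` and `(y · ∇g, y · ∇h)` on the sphere. -/
theorem sq_integral_euler_le (hr : 0 < r) (hrR : r < R)
    (hg : ContDiffOn ℝ 2 g (ball 0 R)) (hh : ContDiffOn ℝ 2 h (ball 0 R)) :
    (∫ y, (g y * euler g y + h y * euler h y) ∂surfaceMeasure 0 r) ^ 2 ≤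
      (∫ y, (g y ^ 2 + h y ^ 2) ∂surfaceMeasure 0 r) *
        ∫ y, (euler g y ^ 2 + euler h y ^ 2) ∂surfaceMeasure 0 r := by
  have hgc := hg.continuousOn
  have hhc := hh.continuousOn
  have heg := (contDiffOn_euler isOpen_ball hg).continuousOn
  have heh := (contDiffOn_euler isOpen_ball hh).continuousOn
  have hS : ∀ {k : EuclideanSpace ℝ (Fin (n + 1)) → ℝ}, ContinuousOn k (ball 0 R) →
      Integrable k (surfaceMeasure 0 r) := fun hk => integrable_surfaceMeasure_zero hr hrR hk
  -- `∫ |t (g, h) + (y · ∇g, y · ∇h)|²` is a nonnegative quadratic polynomial in `t`.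
  have key := discrim_le_zero (a := ∫ y, (g y ^ 2 + h y ^ 2) ∂surfaceMeasure 0 r)
    (b := 2 * ∫ y, (g y * euler g y + h y * euler h y) ∂surfaceMeasure 0 r)
    (c := ∫ y, (euler g y ^ 2 + euler h y ^ 2) ∂surfaceMeasure 0 r) fun t => by
      have h1 : 0 ≤ ∫ y, ((t * g y + euler g y) ^ 2 + (t * h y + euler h y) ^ 2)
          ∂surfaceMeasure 0 r := integral_nonneg fun y => by positivity
      have h2 : (fun y => (t * g y + euler g y) ^ 2 + (t * h y + euler h y) ^ 2) =
          fun y => t * t * (g y ^ 2 + h y ^ 2)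
            + 2 * t * (g y * euler g y + h y * euler h y) + (euler g y ^ 2 + euler h y ^ 2) := by
        funext y; ring
      rw [h2, integral_add (hS (by fun_prop)) (hS (by fun_prop)),
        integral_add (hS (by fun_prop)) (hS (by fun_prop)), integral_const_mul,
        integral_const_mul] at h1
      linarith
  rw [discrim] at key
  linarith

/-- The lower bound of the interior error term: the pointwise bound `neg_energyDensity_sub_le`,
integrated, with `∫_B h²` estimated by the subharmonicity of `h²`. -/
theorem neg_setIntegral_energyDensity_sub_le (hlam : 1 < lam) (hr : 0 < r) (hr1 : r ≤ 1)
    (hrR : r < R) (hg : ContDiffOn ℝ 2 g (ball 0 R)) (hh : ContDiffOn ℝ 2 h (ball 0 R))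
    (hΔh : ∀ y ∈ ball (0 : EuclideanSpace ℝ (Fin (n + 1))) R, Laplacian.laplacian h y = 0) :
    -(r * ∫ y in ball 0 r, energyDensity lam g h y)
        - (n ^ 2 + 2) * (r * ∫ y, (g y ^ 2 + h y ^ 2) ∂surfaceMeasure 0 r) ≤
      ∫ y in ball 0 r, (4 * lam * g y ^ 2 - (n - 1) * (g y * h y) - 2 * (euler g y * h y)) := by
  have hgc := hg.continuousOn
  have hhc := hh.continuousOn
  have heg := (contDiffOn_euler isOpen_ball hg).continuousOn
  have hec := continuousOn_energyDensity (lam := lam) hg hh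
  have hB : ∀ {k : EuclideanSpace ℝ (Fin (n + 1)) → ℝ}, ContinuousOn k (ball 0 R) →
      Integrable k (volume.restrict (ball 0 r)) := fun hk =>
    integrableOn_ball_of_continuousOn volume hk hrR
  have hS : ∀ {k : EuclideanSpace ℝ (Fin (n + 1)) → ℝ}, ContinuousOn k (ball 0 R) →
      Integrable k (surfaceMeasure 0 r) := fun hk => integrable_surfaceMeasure_zero hr hrR hk
  have hhsq : ∫ y in ball 0 r, h y ^ 2 ≤ r * ∫ y, (g y ^ 2 + h y ^ 2) ∂surfaceMeasure 0 r := by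
    have h1 := setIntegral_ball_sq_le_of_harmonic hr hrR hh hΔh
    have h2 : ∫ y, h y ^ 2 ∂surfaceMeasure 0 r ≤ ∫ y, (g y ^ 2 + h y ^ 2) ∂surfaceMeasure 0 r :=
      integral_mono (hS (by fun_prop)) (hS (by fun_prop)) fun y =>
        le_add_of_nonneg_left (sq_nonneg (g y))
    have h3 : 0 ≤ ∫ y in ball 0 r, h y ^ 2 := integral_nonneg fun y => by positivity
    have h4 : 0 ≤ (n : ℝ) * ∫ y in ball 0 r, h y ^ 2 := by positivity
    have h5 := mul_le_mul_of_nonneg_left h2 hr.le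
    linarith
  have h1 : ∫ y in ball 0 r, (-r * energyDensity lam g h y - (n ^ 2 + 2) * h y ^ 2) ≤
      ∫ y in ball 0 r,
        (4 * lam * g y ^ 2 - (n - 1) * (g y * h y) - 2 * (euler g y * h y)) := by
    refine setIntegral_mono_on (hB (by fun_prop)) (hB (by fun_prop)) measurableSet_ball
      fun y hy => ?_
    have hyr : ‖y‖ ≤ r := (mem_ball_zero_iff.1 hy).le
    exact neg_energyDensity_sub_le hlam hr hr1 ((abs_euler_le g y).trans (by gcongr))
  rw [integral_sub (hB (by fun_prop)) (hB (by fun_prop)), integral_const_mul,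
    integral_const_mul] at h1
  have h2 : ((n : ℝ) ^ 2 + 2) * ∫ y in ball 0 r, h y ^ 2 ≤
      (n ^ 2 + 2) * (r * ∫ y, (g y ^ 2 + h y ^ 2) ∂surfaceMeasure 0 r) := by
    gcongr
  linarith

/-- The Rellich identities for `g` and `h`, combined with `2 lam` times the divergence theorem for
the field `g² y`; the choice of the weight makes the boundary terms in `g²` cancel. -/
theorem rellich_energyDensity (hr : 0 < r) (hrR : r < R)
    (hg : ContDiffOn ℝ 2 g (ball 0 R)) (hh : ContDiffOn ℝ 2 h (ball 0 R))
    (hΔg : ∀ y ∈ ball (0 : EuclideanSpace ℝ (Fin (n + 1))) R,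
      Laplacian.laplacian g y = 2 * lam * g y + h y)
    (hΔh : ∀ y ∈ ball (0 : EuclideanSpace ℝ (Fin (n + 1))) R, Laplacian.laplacian h y = 0) :
    2 * ∫ y, (euler g y ^ 2 + euler h y ^ 2) ∂surfaceMeasure 0 r
        + r * ((n - 1) * ∫ y in ball 0 r, energyDensity lam g h y)
        + r * ∫ y in ball 0 r,
          (4 * lam * g y ^ 2 - (n - 1) * (g y * h y) - 2 * (euler g y * h y)) =
      r ^ 2 * ∫ y, energyDensity lam g h y ∂surfaceMeasure 0 r
        - r ^ 2 * ∫ y, g y * h y ∂surfaceMeasure 0 r := by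
  have hgc := hg.continuousOn
  have hhc := hh.continuousOn
  have hgg := (contDiffOn_norm_gradient_sq isOpen_ball hg).continuousOn
  have hgh := (contDiffOn_norm_gradient_sq isOpen_ball hh).continuousOn
  have heg := (contDiffOn_euler isOpen_ball hg).continuousOn
  have heh := (contDiffOn_euler isOpen_ball hh).continuousOn
  have hec := continuousOn_energyDensity (lam := lam) hg hh
  have hB : ∀ {k : EuclideanSpace ℝ (Fin (n + 1)) → ℝ}, ContinuousOn k (ball 0 R) →
      Integrable k (volume.restrict (ball 0 r)) := fun hk =>
    integrableOn_ball_of_continuousOn volume hk hrR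
  have hS : ∀ {k : EuclideanSpace ℝ (Fin (n + 1)) → ℝ}, ContinuousOn k (ball 0 R) →
      Integrable k (surfaceMeasure 0 r) := fun hk => integrable_surfaceMeasure_zero hr hrR hk
  have hsub : ∀ {y : EuclideanSpace ℝ (Fin (n + 1))}, y ∈ ball 0 r → y ∈ ball 0 R :=
    fun hy => ball_subset_ball hrR.le hy
  have h1 := mul_setIntegral_rellich hr hrR hg
  have h2 := mul_setIntegral_rellich hr hrR hh
  have h3 := mul_setIntegral_sq_add hr hrR hg
  rw [setIntegral_congr_fun (g := fun y => ((n : ℝ) - 1) * ‖gradient g y‖ ^ 2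
      - 2 * euler g y * (2 * lam * g y + h y))
      measurableSet_ball fun y hy => by simp only [hΔg y (hsub hy)]] at h1
  rw [setIntegral_congr_fun (g := fun y => ((n : ℝ) - 1) * ‖gradient h y‖ ^ 2)
      measurableSet_ball fun y hy => by simp only [hΔh y (hsub hy)]; ring] at h2
  have h4 : r * ∫ y in ball 0 r, ((n - 1) * energyDensity lam g h y
        + (4 * lam * g y ^ 2 - (n - 1) * (g y * h y) - 2 * (euler g y * h y))) =
      ∫ y, (r ^ 2 * (energyDensity lam g h y - g y * h y)
        - 2 * (euler g y ^ 2 + euler h y ^ 2)) ∂surfaceMeasure 0 r := by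
    have e1 : (fun y => (n - 1) * energyDensity lam g h y
        + (4 * lam * g y ^ 2 - (n - 1) * (g y * h y) - 2 * (euler g y * h y))) = fun y =>
        (((n : ℝ) - 1) * ‖gradient g y‖ ^ 2 - 2 * euler g y * (2 * lam * g y + h y)
          + ((n : ℝ) - 1) * ‖gradient h y‖ ^ 2)
        + 2 * lam * (((n : ℝ) + 1) * g y ^ 2 + 2 * (g y * euler g y)) := by
      funext y; simp only [energyDensity]; ring
    have e2 : (fun y => r ^ 2 * (energyDensity lam g h y - g y * h y)
        - 2 * (euler g y ^ 2 + euler h y ^ 2)) =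
        fun y => (r ^ 2 * ‖gradient g y‖ ^ 2 - 2 * euler g y ^ 2
          + (r ^ 2 * ‖gradient h y‖ ^ 2 - 2 * euler h y ^ 2)) + 2 * lam * (r ^ 2 * g y ^ 2) := by
      funext y; simp only [energyDensity]; ring
    rw [e1, e2, integral_add (hB (by fun_prop)) (hB (by fun_prop)),
      integral_add (hB (by fun_prop)) (hB (by fun_prop)),
      integral_add (hS (by fun_prop)) (hS (by fun_prop)),
      integral_add (hS (by fun_prop)) (hS (by fun_prop)), integral_const_mul (2 * lam),
      integral_const_mul (2 * lam), ← h1, ← h2, ← h3]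
    ring
  rw [integral_add (hB (by fun_prop)) (hB (by fun_prop)), integral_const_mul,
    integral_sub (hS (by fun_prop)) (hS (by fun_prop)), integral_const_mul, integral_const_mul,
    integral_sub (hS hec) (hS (by fun_prop))] at h4
  linarith

/-- The almost monotonicity of the frequency of a pair `Δg = 2 lam g + h`, `Δh = 0`. -/
theorem exists_hasDerivAt_of_laplacian_eq (hlam : 1 < lam) (hr : 0 < r) (hr1 : r ≤ 1) (hrR : r < R)
    (hg : ContDiffOn ℝ 2 g (ball 0 R)) (hh : ContDiffOn ℝ 2 h (ball 0 R))
    (hΔg : ∀ y ∈ ball (0 : EuclideanSpace ℝ (Fin (n + 1))) R,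
      Laplacian.laplacian g y = 2 * lam * g y + h y)
    (hΔh : ∀ y ∈ ball (0 : EuclideanSpace ℝ (Fin (n + 1))) R, Laplacian.laplacian h y = 0)
    {D H : ℝ → ℝ}
    (hD : D = fun s => ∫ y in ball 0 s, energyDensity lam g h y)
    (hH : H = fun s => ∫ y, (g y ^ 2 + h y ^ 2) ∂surfaceMeasure 0 s)
    (hN : 1 ≤ r * (D r / H r)) :
    ∃ D' H' : ℝ, HasDerivAt D D' r ∧ HasDerivAt H H' r ∧
      -((n : ℝ) ^ 2 + 4) ≤ 1 / r + D' / D r - H' / H r := by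
  have hgc := hg.continuousOn
  have hhc := hh.continuousOn
  have hS : ∀ {k : EuclideanSpace ℝ (Fin (n + 1)) → ℝ}, ContinuousOn k (ball 0 R) →
      Integrable k (surfaceMeasure 0 r) := fun hk => integrable_surfaceMeasure_zero hr hrR hk
  have hDr : D r = ∫ y in ball 0 r, energyDensity lam g h y := by rw [hD]
  have hHr : H r = ∫ y, (g y ^ 2 + h y ^ 2) ∂surfaceMeasure 0 r := by rw [hH]
  have hP := mul_setIntegral_energyDensity hr hrR hg hh hΔg hΔh
  have hPQ := sq_integral_euler_le hr hrR hg hh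
  have hK := neg_setIntegral_energyDensity_sub_le hlam hr hr1 hrR hg hh hΔh
  have hRe := rellich_energyDensity hr hrR hg hh hΔg hΔh
  have hH0 : 0 ≤ H r := by rw [hHr]; exact integral_nonneg fun y => by positivity
  have hgh : -(∫ y, g y * h y ∂surfaceMeasure 0 r) ≤ H r / 2 := by
    rw [hHr, ← integral_neg, ← integral_div]
    refine integral_mono (hS (by fun_prop)) (hS (by fun_prop)) fun y => ?_
    simp only
    linarith [sq_nonneg (g y + h y), add_sq (g y) (h y)]
  have hgh' := mul_le_mul_of_nonneg_left hgh (sq_nonneg r)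
  rw [← hDr] at hP hK hRe
  rw [← hHr] at hPQ hK
  have hHd : HasDerivAt H (n / r * H r + 2 * D r) r := by
    have hf : ContDiffOn ℝ 1 (fun y => g y ^ 2 + h y ^ 2) (ball 0 R) :=
      ((hg.pow 2).add (hh.pow 2)).of_le (by norm_num)
    have h1 := hasDerivAt_integral_surfaceMeasure hr hrR hf
    rw [← hH, ← hHr] at h1
    have h2 : ∫ y, euler (fun y => g y ^ 2 + h y ^ 2) y ∂surfaceMeasure 0 r =
        2 * ∫ y, (g y * euler g y + h y * euler h y) ∂surfaceMeasure 0 r := by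
      rw [← integral_const_mul]
      refine integral_surfaceMeasure_zero_congr hr fun y hy => ?_
      have hy' : ball (0 : EuclideanSpace ℝ (Fin (n + 1))) R ∈ 𝓝 y :=
        isOpen_ball.mem_nhds (by simpa [hy] using hrR)
      have hgd : DifferentiableAt ℝ g y := (hg.contDiffAt hy').differentiableAt (by simp)
      have hhd : DifferentiableAt ℝ h y := (hh.contDiffAt hy').differentiableAt (by simp)
      rw [euler, ((hgd.hasFDerivAt.pow 2).fun_add (hhd.hasFDerivAt.pow 2)).fderiv]
      simp [euler]
      ring
    refine h1.congr_deriv ?_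
    rw [h2, ← hP]
    field_simp
  have hDd : HasDerivAt D (∫ y, energyDensity lam g h y ∂surfaceMeasure 0 r) r := by
    rw [hD]
    exact hasDerivAt_setIntegral_ball_surfaceMeasure hr hrR (continuousOn_energyDensity hg hh)
  exact ⟨_, _, hDd, hHd, neg_le_logDeriv_of_bounds hr hr1 hH0 hN hP hPQ (by linarith) hK⟩

end Frequency

/-! ### The frequency of a solution -/

/-- The frequency of an eigenfunction is differentiable at a radius where it is at least `1`, and
its logarithmic derivative there is bounded below by a constant that depends only on `n`. -/
theorem IsEigenfunctionOn.exists_hasDerivAt_log_frequency {n : ℕ} {lam : ℝ} (hlam : 1 < lam)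
    {Ω : Set (EuclideanSpace ℝ (Fin n))} (hΩ : IsOpen Ω) {u : EuclideanSpace ℝ (Fin n) → ℝ}
    (hu : IsEigenfunctionOn Ω lam u) {y₀ : EuclideanSpace ℝ (Fin (n + 1))} {r : ℝ} (hr : 0 < r)
    (hr1 : r ≤ 1) (hball : ∀ y ∈ closedBall y₀ r, spacePart y ∈ Ω)
    (hN : 1 ≤ frequency lam u y₀ r) :
    ∃ L : ℝ, HasDerivAt (fun s => Real.log (frequency lam u y₀ s)) L r ∧
      -((n : ℝ) ^ 2 + 4) ≤ L := by
  have hlam0 : 0 ≤ lam := by linarith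
  have hU := isOpen_preimage_spacePart hΩ
  -- The closed ball is compact, so a slightly larger concentric ball still lies over `Ω`.
  obtain ⟨δ, hδ, hδU⟩ :=
    (isCompact_closedBall y₀ r).exists_thickening_subset_open hU fun y hy => hball y hy
  rw [thickening_closedBall hδ hr.le] at hδU
  have hrR : r < δ + r := by linarith
  have hmem : ∀ y ∈ ball (0 : EuclideanSpace ℝ (Fin (n + 1))) (δ + r),
      y₀ + y ∈ spacePart ⁻¹' Ω := fun y hy => hδU (by simpa using hy)
  have hg : ContDiffOn ℝ 2 (fun y => gFun lam u (y₀ + y)) (ball 0 (δ + r)) :=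
    (contDiffOn_lift (k := 2) (hu.1.of_le (by norm_num))).comp (by fun_prop) hmem
  have hh : ContDiffOn ℝ 2 (fun y => hFun lam u (y₀ + y)) (ball 0 (δ + r)) :=
    (contDiffOn_lift (k := 2) (hu.contDiffOn_vFun hΩ)).comp (by fun_prop) hmem
  have hΔ : ∀ (f : EuclideanSpace ℝ (Fin (n + 1)) → ℝ) (y),
      Laplacian.laplacian (fun z => f (y₀ + z)) y = Laplacian.laplacian f (y₀ + y) := by
    intro f y
    simp only [InnerProductSpace.laplacian_eq_iteratedFDeriv_stdOrthonormalBasis,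
      iteratedFDeriv_comp_add_left]
  have hgrad : ∀ (f : EuclideanSpace ℝ (Fin (n + 1)) → ℝ) (y),
      gradient (fun z => f (y₀ + z)) y = gradient f (y₀ + y) := by
    intro f y
    rw [gradient, gradient, fderiv_comp_add_left]
  have hD : D lam u y₀ = fun s => ∫ y in ball 0 s,
      energyDensity lam (fun z => gFun lam u (y₀ + z)) (fun z => hFun lam u (y₀ + z)) y := by
    funext s
    have hpre : (fun y => y₀ + y) ⁻¹' ball y₀ s = ball 0 s := by
      ext y; simp
    rw [D, ← (measurePreserving_add_left volume y₀).setIntegral_preimage_emb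
      (measurableEmbedding_addLeft y₀), hpre]
    simp only [energyDensity, hgrad]
  have hH : ∀ s, 0 < s → H lam u y₀ s =
      ∫ y, (gFun lam u (y₀ + y) ^ 2 + hFun lam u (y₀ + y) ^ 2) ∂surfaceMeasure 0 s := by
    intro s hs
    rw [H, integral_surfaceMeasure y₀ hs, integral_surfaceMeasure_zero hs]
  have hN1 := hN
  rw [frequency, hH r hr] at hN
  obtain ⟨D', H', hD', hH', hle⟩ := exists_hasDerivAt_of_laplacian_eq hlam hr hr1 hrR hg hh
    (fun y hy => by rw [hΔ, hu.laplacian_gFun hΩ hlam0 (hmem y hy)])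
    (fun y hy => by rw [hΔ, hu.laplacian_hFun hΩ hlam0 (hmem y hy)]) hD rfl hN
  have hH'' : HasDerivAt (H lam u y₀) H' r :=
    hH'.congr_of_eventuallyEq (by filter_upwards [lt_mem_nhds hr] with s hs using hH s hs)
  simp only [← hH r hr] at hle
  -- If `H` or `D` vanished, the frequency would be `0`, also by the convention for `x / 0`.
  have hHne : H lam u y₀ r ≠ 0 := by
    intro h0
    rw [frequency, h0] at hN1
    simp at hN1
    linarith
  have hDne : D lam u y₀ r ≠ 0 := by
    intro h0
    rw [frequency, h0] at hN1
    simp at hN1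
    linarith
  have hfne : frequency lam u y₀ r ≠ 0 := by linarith
  have hfreq : HasDerivAt (fun s => Real.log (frequency lam u y₀ s))
      (1 / r + D' / D lam u y₀ r - H' / H lam u y₀ r) r := by
    have h1 := ((hasDerivAt_id r).mul (hD'.div hH'' hHne)).log hfne
    refine h1.congr_deriv ?_
    simp only [id, Pi.mul_apply, Pi.div_apply]
    field_simp
    ring
  exact ⟨_, hfreq, hle⟩

end Biharmonic

theorem theorem2p3 (n : ℕ) (hn : 2 ≤ n) :
    ∃ C₀ > (0 : ℝ), ∃ C > (0 : ℝ),
      ∀ (lam : ℝ), 1 < lam →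
      ∀ (Ω : Set (EuclideanSpace ℝ (Fin n))), IsOpen Ω →
      ∀ (u : EuclideanSpace ℝ (Fin n) → ℝ), Biharmonic.IsEigenfunctionOn Ω lam u →
      ∀ (y₀ : EuclideanSpace ℝ (Fin (n + 1))) (r : ℝ), 0 < r → r ≤ 1 →
        (∀ y ∈ Metric.closedBall y₀ r, Biharmonic.spacePart y ∈ Ω) →
        C₀ ≤ Biharmonic.frequency lam u y₀ r →
          DifferentiableAt ℝ (fun s : ℝ => Real.log (Biharmonic.frequency lam u y₀ s)) r ∧
            -C ≤ deriv (fun s : ℝ => Real.log (Biharmonic.frequency lam u y₀ s)) r := by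
  refine ⟨1, one_pos, (n : ℝ) ^ 2 + 4, by positivity, ?_⟩
  intro lam hlam Ω hΩ u hu y₀ r hr hr1 hball hN
  obtain ⟨L, hL, hle⟩ := hu.exists_hasDerivAt_log_frequency hlam hΩ hr hr1 hball hN
  exact ⟨hL.differentiableAt, hL.deriv ▸ hle⟩
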